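/- Let $\mathbb D$ be the open unit disk. Let $H^2$ be the Hardy space of analytic functions $f$ on $\mathbb D$ with $\sup_{0<r<1}\frac1{2\pi}\int_0^{2\pi}|f(re^{i\theta})|^2\,d\theta<\infty$, with norm $\|f\|_2=\big(\frac1{2\pi}\int_0^{2\pi}|f(e^{i\theta})|^2\,d\theta\big)^{1/2}$, where $f(e^{i\theta})$ is the radial boundary value of $f$. For an integer $k\ge 0$ let $H^{k,2}$ be the space of $f\in H^2$ with $f^{(j)}\in H^2$ for $1\le j\le k$ (complex derivatives), with norm $\|f\|_{k,2}=\big(\sum_{j=0}^k\|f^{(j)}\|_2^2\big)^{1/2}$. For a subarc $I$ of the unit circle of length $2\pi\lambda$, $\lambda\in(0,1)$, put $\|u\|_{2,I}=\big(\frac1{2\pi\lambda}\int_I|u(e^{i\theta})|^2\,d\theta\big)^{1/2}$ and $\|f\|_{W^{m,2}(I)}=\big(\sum_{j=0}^m\|\partial^j f/\partial\theta^j\|_{2,I}^2\big)^{1/2}$, where the derivatives are the weak derivatives, with respect to $\theta$, of the boundary function $\theta\mapsto f(e^{i\theta})$ on $I$. Let $m,k$ be integers with $0\le m<k$. There exist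 constants $\alpha_{k,m}>0$ and $\beta_{k,m}>0$, depending only on $k$ and $m$, such that for every $\lambda\in(0,1)$, every subarc $I$ of the unit circle of length $2\pi\lambda$, and every $f\in H^{k,2}$ with $\|f\|_{k,2}\le 1$ and $\|f\|_{W^{m,2}(I)}\le\beta_{k,m}$, one has $$\|f\|_{m,2}\le\frac{\alpha_{k,m}}{\big(\lambda\log(1/\|f\|_{W^{m,2}(I)})\big)^{k-m}},$$ where the right-hand side is read as $0$ if $\|f\|_{W^{m,2}(I)}=0$. -/

import Mathlib

open MeasureTheory Filter Topology
open scoped ContDiff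

noncomputable section

namespace HardySobolev

/-- The boundary value `f(e^{iθ})`: the radial limit of `f` at `e^{iθ}`, taken from inside the
unit disk. -/
def boundaryValue (f : ℂ → ℂ) (θ : ℝ) : ℂ :=
  limUnder (𝓝[<] (1 : ℝ)) (fun r : ℝ => f (circleMap 0 r θ))

/-- Membership in the Hardy space `H²` of the unit disk: `f` is analytic in the open disk and its
`L²` means over the circles of radius `r < 1` are bounded. Values of `f` outside the open disk
play no role. -/
def MemHardy (f : ℂ → ℂ) : Prop :=
  DifferentiableOn ℂ f (Metric.ball 0 1) ∧
    ∃ C : ℝ, ∀ r ∈ Set.Ioo (0 : ℝ) 1,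
      1 / (2 * Real.pi) * ∫ θ in (0 : ℝ)..(2 * Real.pi), ‖f (circleMap 0 r θ)‖ ^ 2 ≤ C

/-- The norm `‖f‖₂` of `H²`: the normalized `L²` norm of the boundary values. -/
def hardyNorm (f : ℂ → ℂ) : ℝ :=
  Real.sqrt (1 / (2 * Real.pi) *
    ∫ θ in (0 : ℝ)..(2 * Real.pi), ‖boundaryValue f θ‖ ^ 2)

/-- Membership in the Hardy–Sobolev space `H^{k,2}`: `f` and its complex derivatives up to order
`k` belong to `H²`. -/
def MemHardySobolev (k : ℕ) (f : ℂ → ℂ) : Prop :=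
  ∀ j ≤ k, MemHardy (iteratedDeriv j f)

/-- The norm `‖f‖_{k,2} = (∑_{j ≤ k} ‖f^{(j)}‖₂²)^{1/2}`. -/
def hardySobolevNorm (k : ℕ) (f : ℂ → ℂ) : ℝ :=
  Real.sqrt (∑ j ∈ Finset.range (k + 1), hardyNorm (iteratedDeriv j f) ^ 2)

/-- The unit ball `B_{k,2}` of `H^{k,2}`. -/
def unitBall (k : ℕ) : Set (ℂ → ℂ) :=
  {f | MemHardySobolev k f ∧ hardySobolevNorm k f ≤ 1}

/-- The angles of the subarc of the unit circle that starts at `e^{ia}` and has length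
`2π·lam`. -/
def arc (a lam : ℝ) : Set ℝ := Set.Ioo a (a + 2 * Real.pi * lam)

/-- The normalized norm of `L²(I)`, where `I` is the subarc `arc a lam`, for a function `u` of the
angle. -/
def arcNorm (a lam : ℝ) (u : ℝ → ℂ) : ℝ :=
  Real.sqrt (1 / (2 * Real.pi * lam) * ∫ θ in arc a lam, ‖u θ‖ ^ 2)

/-- `g` is the weak derivative of order `j` of `u` (with respect to the angle) on the subarc, both
functions being in `L²` of the subarc. -/
def IsWeakDeriv (a lam : ℝ) (j : ℕ) (u g : ℝ → ℂ) : Prop :=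
  MemLp u 2 (volume.restrict (arc a lam)) ∧ MemLp g 2 (volume.restrict (arc a lam)) ∧
    ∀ φ : ℝ → ℝ, ContDiff ℝ ∞ φ → HasCompactSupport φ → tsupport φ ⊆ arc a lam →
      ∫ θ in arc a lam, iteratedDeriv j φ θ • u θ =
        (-1) ^ j * ∫ θ in arc a lam, φ θ • g θ

open Classical in
/-- The weak derivative `∂^j u / ∂θ^j` on the subarc, which is unique up to a null set (with the
value `0` if `u` has none; this does not occur for traces of functions of `H^{k,2}` with
`j < k`, which are of class `C^{k-1}` in the angle). -/
def weakDeriv (a lam : ℝ) (j : ℕ) (u : ℝ → ℂ) : ℝ → ℂ :=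
  if h : ∃ g, IsWeakDeriv a lam j u g then h.choose else 0

/-- The norm `‖f‖_{W^{m,2}(I)}` of the trace of `f` on the subarc `I` given by `arc a lam`. -/
def arcSobolevNorm (a lam : ℝ) (m : ℕ) (f : ℂ → ℂ) : ℝ :=
  Real.sqrt (∑ j ∈ Finset.range (m + 1),
    arcNorm a lam (weakDeriv a lam j (boundaryValue f)) ^ 2)

end HardySobolev

end

/-!
On the boundary `z d/dz = -i ∂/∂θ`, so in terms of the Taylor coefficients `aₙ` of `f` the weak
derivative of order `j` on the arc has the modulus of `∑ nʲ aₙ e^{inθ}`. The norm of `f^{(j)}` is at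
most the norm of that series, and the theorem reduces to an estimate for one power series
`g = ∑ bₙ zⁿ` with `∑ n^{2q} |bₙ|² ≤ A`, `q = k - m ≥ 1`, whose boundary function has normalized
norm at most `T` on the arc: `∑ |bₙ|² ≤ K / (λ log (1/T))^{2q}` (`exists_tsum_sq_le`).

The estimate for `g` is a two-constants theorem in `L²`. Let `ω` be the harmonic measure of the arc
and `h` the outer function with `|h|² = T^{-ω}`. Means of `|g h|²` over circles increase with the
radius, and on the boundary `|h|²` is `1/T` on the arc and `1` elsewhere. Hence the mean of `|g|²`
over the circle of radius `r = 1 - s` is at most `T^{min ω} (T + ‖g‖²)`, where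
`ω ≥ λ (1 - r) / (1 + r) ≥ λ s / 2` on that circle (`tsum_sq_mul_pow_le`). With
`s = 10 / (λ log (1/T))` the first factor is at most `e⁻⁵`. The frequencies `n ≤ 1/s` of `g` are
seen on that circle up to the factor `e⁴`, and the others contribute at most `s^{2q} A`; so the
low frequencies are absorbed in `‖g‖²`, and `‖g‖² ≤ T + 2 s^{2q} A`. The absorption is what gives
the sharp power of the logarithm.

The hypothesis `‖f‖_{k,2} ≤ 1` speaks of radial limits of `f^{(k)}`, a general function of `H²`, and
has to be turned into a bound for coefficients. This is Fatou's theorem (`MemHardy.hasSum_sq`). A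
function `F` of `H²` is the derivative of a `P` that is continuous in the closed disk and has an
absolutely continuous boundary function, whose angular derivative exists almost everywhere by
Lebesgue's theorem. At such a point the radial limit of `P'` exists (`tendsto_deriv_radial`): in
Cauchy's formula for `P'(rζ)` one may subtract the same integral for the reflected point `ζ/r`,
which vanishes, and the difference of the kernels is dominated by the Poisson kernel.
-/

noncomputable section

namespace HardySobolev

open Metric Set Real
open scoped ComplexConjugate

/-! ### Power series and Parseval's identity on circles -/

/-- The sum `∑ cₙ zⁿ` of the power series with coefficients `c`. -/
def powerSum (c : ℕ → ℂ) (z : ℂ) : ℂ := ∑' n, c n * z ^ n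

/-- The Taylor coefficients of `F` at the origin. -/
def taylorCoeff (F : ℂ → ℂ) (n : ℕ) : ℂ := (n.factorial : ℂ)⁻¹ * iteratedDeriv n F 0

lemma norm_mul_pow_le {c z : ℂ} {n : ℕ} (hz : ‖z‖ ≤ 1) : ‖c * z ^ n‖ ≤ ‖c‖ := by
  rw [norm_mul, norm_pow]
  exact mul_le_of_le_one_right (norm_nonneg _) (pow_le_one₀ (norm_nonneg _) hz)

lemma hasSum_powerSum {c : ℕ → ℂ} (hc : Summable fun n => ‖c n‖) {z : ℂ} (hz : ‖z‖ ≤ 1) :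
    HasSum (fun n => c n * z ^ n) (powerSum c z) :=
  (Summable.of_norm_bounded hc fun _ => norm_mul_pow_le hz).hasSum

lemma continuousOn_powerSum {c : ℕ → ℂ} (hc : Summable fun n => ‖c n‖) :
    ContinuousOn (powerSum c) (closedBall 0 1) :=
  continuousOn_tsum (fun n => by fun_prop) hc fun n z hz =>
    norm_mul_pow_le (by simpa using hz)

lemma differentiableOn_powerSum {c : ℕ → ℂ} (hc : Summable fun n => ‖c n‖) :
    DifferentiableOn ℂ (powerSum c) (ball 0 1) :=
  Complex.differentiableOn_tsum_of_summable_norm hc (fun n => by fun_prop) isOpen_ball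
    fun n z hz => norm_mul_pow_le (by simpa using (mem_ball.1 hz).le)

lemma diffContOnCl_powerSum {c : ℕ → ℂ} (hc : Summable fun n => ‖c n‖) :
    DiffContOnCl ℂ (powerSum c) (ball 0 1) :=
  ⟨differentiableOn_powerSum hc, by
    rw [closure_ball _ one_ne_zero]; exact continuousOn_powerSum hc⟩

lemma continuous_powerSum_circleMap {c : ℕ → ℂ} (hc : Summable fun n => ‖c n‖) :
    Continuous fun θ : ℝ => powerSum c (circleMap 0 1 θ) :=
  (continuousOn_powerSum hc).comp_continuous (continuous_circleMap 0 1) fun θ => by simp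

lemma circleMap_zero_one_pow (θ : ℝ) (n : ℕ) :
    circleMap 0 1 θ ^ n = Complex.exp (n * Complex.I * θ) := by
  simp only [circleMap, zero_add, Complex.ofReal_one, one_mul, ← Complex.exp_nat_mul]
  ring_nf

lemma circleMap_zero_eq_mul (r θ : ℝ) : circleMap 0 r θ = r * circleMap 0 1 θ := by
  simp [circleMap]

lemma integral_circleMap_pow_mul_conj (n m : ℕ) :
    ∫ θ in (0 : ℝ)..(2 * π), circleMap 0 1 θ ^ n * conj (circleMap 0 1 θ ^ m) =
      if n = m then 2 * π else 0 := by
  have h : ∀ θ : ℝ, circleMap 0 1 θ ^ n * conj (circleMap 0 1 θ ^ m) =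
      Complex.exp ((((n : ℂ) - m) * Complex.I) * θ) := by
    intro θ
    rw [circleMap_zero_one_pow, circleMap_zero_one_pow, ← Complex.exp_conj, ← Complex.exp_add]
    simp only [map_mul, map_natCast, Complex.conj_I, Complex.conj_ofReal]
    ring_nf
  simp_rw [h]
  split_ifs with hnm
  · subst hnm; simp
  · have hne : ((n : ℂ) - m) * Complex.I ≠ 0 :=
      mul_ne_zero (sub_ne_zero.2 (by exact_mod_cast hnm)) Complex.I_ne_zero
    rw [integral_exp_mul_complex hne]
    have : Complex.exp (((n : ℂ) - m) * Complex.I * ((2 * π : ℝ) : ℂ)) = 1 := by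
      rw [Complex.exp_eq_one_iff]
      exact ⟨(n : ℤ) - m, by push_cast; ring⟩
    rw [this]; simp

lemma integral_powerSum_mul_conj_pow {c : ℕ → ℂ} (hc : Summable fun n => ‖c n‖) (m : ℕ) :
    ∫ θ in (0 : ℝ)..(2 * π), powerSum c (circleMap 0 1 θ) * conj (circleMap 0 1 θ ^ m) =
      2 * π * c m := by
  have H := intervalIntegral.hasSum_integral_of_dominated_convergence (a := 0) (b := 2 * π)
    (μ := volume)
    (F := fun n (θ : ℝ) => c n * circleMap 0 1 θ ^ n * conj (circleMap 0 1 θ ^ m))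
    (f := fun θ => powerSum c (circleMap 0 1 θ) * conj (circleMap 0 1 θ ^ m))
    (fun n _ => ‖c n‖) (fun n => Continuous.aestronglyMeasurable (by fun_prop))
    (fun n => ae_of_all _ fun θ _ => by simp) (ae_of_all _ fun _ _ => hc) (by simp)
    (ae_of_all _ fun θ _ => (hasSum_powerSum hc (by simp)).mul_right _)
  rw [← H.tsum_eq, tsum_eq_single m]
  · simp_rw [mul_assoc, intervalIntegral.integral_const_mul, integral_circleMap_pow_mul_conj]
    simp only [if_true]
    push_cast; ring
  · intro n hn
    simp_rw [mul_assoc, intervalIntegral.integral_const_mul, integral_circleMap_pow_mul_conj]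
    simp [hn]

/-- **Parseval's identity** for an absolutely convergent power series on the unit circle. -/
lemma hasSum_sq_of_summable_norm {c : ℕ → ℂ} (hc : Summable fun n => ‖c n‖) :
    HasSum (fun n => ‖c n‖ ^ 2)
      (1 / (2 * π) * ∫ θ in (0 : ℝ)..(2 * π), ‖powerSum c (circleMap 0 1 θ)‖ ^ 2) := by
  have hcont := continuous_powerSum_circleMap hc
  have hbd : ∀ θ : ℝ, ‖powerSum c (circleMap 0 1 θ)‖ ≤ ∑' n, ‖c n‖ := fun θ =>
    tsum_of_norm_bounded hc.hasSum fun n => norm_mul_pow_le (by simp)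
  have H := intervalIntegral.hasSum_integral_of_dominated_convergence (a := 0) (b := 2 * π)
    (μ := volume)
    (F := fun n (θ : ℝ) => conj (c n) *
      (powerSum c (circleMap 0 1 θ) * conj (circleMap 0 1 θ ^ n)))
    (f := fun θ => powerSum c (circleMap 0 1 θ) * conj (powerSum c (circleMap 0 1 θ)))
    (fun n _ => ‖c n‖ * ∑' n, ‖c n‖)
    (fun n => Continuous.aestronglyMeasurable (by fun_prop))
    (fun n => ae_of_all _ fun θ _ => by
      simp only [norm_mul, RCLike.norm_conj, norm_pow, norm_circleMap_zero, abs_one, one_pow,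
        mul_one]
      exact mul_le_mul_of_nonneg_left (hbd θ) (norm_nonneg _))
    (ae_of_all _ fun _ _ => hc.mul_right _) (by simp)
    (ae_of_all _ fun θ _ => by
      refine (((Complex.hasSum_conj'.2 (hasSum_powerSum hc (z := circleMap 0 1 θ)
        (by simp))).mul_left (powerSum c (circleMap 0 1 θ)))).congr_fun fun n => ?_
      rw [map_mul]; ring)
  have hR : HasSum (fun n => 2 * π * ‖c n‖ ^ 2)
      (∫ θ in (0 : ℝ)..(2 * π), ‖powerSum c (circleMap 0 1 θ)‖ ^ 2) := by
    rw [← Complex.hasSum_ofReal, ← intervalIntegral.integral_ofReal]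
    simp_rw [intervalIntegral.integral_const_mul, integral_powerSum_mul_conj_pow hc,
      Complex.mul_conj'] at H
    push_cast
    refine H.congr_fun fun n => ?_
    rw [mul_left_comm, Complex.conj_mul']
  refine (hR.mul_left (1 / (2 * π))).congr_fun fun n => ?_
  field_simp

lemma hasSum_taylorCoeff {F : ℂ → ℂ} (hF : DifferentiableOn ℂ F (ball 0 1)) {z : ℂ}
    (hz : ‖z‖ < 1) : HasSum (fun n => taylorCoeff F n * z ^ n) (F z) := by
  refine (Complex.hasSum_taylorSeries_on_ball hF (z := z) (by simpa using hz)).congr_fun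
    fun n => ?_
  simp only [taylorCoeff, smul_eq_mul, sub_zero]
  ring

lemma summable_norm_taylorCoeff_mul_pow {F : ℂ → ℂ} (hF : DifferentiableOn ℂ F (ball 0 1))
    {r : ℝ} (hr0 : 0 ≤ r) (hr1 : r < 1) :
    Summable fun n => ‖taylorCoeff F n * (r : ℂ) ^ n‖ :=
  (hasSum_taylorCoeff hF (by simpa [abs_of_nonneg hr0] using hr1)).summable.norm

/-- **Parseval's identity** on the circle of radius `r`. -/
lemma hasSum_sq_mul_pow {c : ℕ → ℂ} {r : ℝ} (hr0 : 0 ≤ r)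
    (hc : Summable fun n => ‖c n * (r : ℂ) ^ n‖) :
    HasSum (fun n => ‖c n‖ ^ 2 * r ^ (2 * n))
      (1 / (2 * π) * ∫ θ in (0 : ℝ)..(2 * π), ‖powerSum c (circleMap 0 r θ)‖ ^ 2) := by
  have h := hasSum_sq_of_summable_norm hc
  have hpow : ∀ θ : ℝ, powerSum (fun n => c n * (r : ℂ) ^ n) (circleMap 0 1 θ) =
      powerSum c (circleMap 0 r θ) := fun θ => tsum_congr fun n => by
    rw [circleMap_zero_eq_mul r, mul_pow, mul_assoc]
  simp_rw [hpow] at h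
  refine h.congr_fun fun n => ?_
  rw [norm_mul, norm_pow, Complex.norm_real, norm_of_nonneg hr0, mul_pow, ← pow_mul, mul_comm n]

lemma hasSum_sq_taylorCoeff {F : ℂ → ℂ} (hF : DifferentiableOn ℂ F (ball 0 1))
    {r : ℝ} (hr0 : 0 ≤ r) (hr1 : r < 1) :
    HasSum (fun n => ‖taylorCoeff F n‖ ^ 2 * r ^ (2 * n))
      (1 / (2 * π) * ∫ θ in (0 : ℝ)..(2 * π), ‖F (circleMap 0 r θ)‖ ^ 2) := by
  have h := hasSum_sq_mul_pow hr0 (summable_norm_taylorCoeff_mul_pow hF hr0 hr1)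
  have hF' : ∀ θ : ℝ, powerSum (taylorCoeff F) (circleMap 0 r θ) = F (circleMap 0 r θ) :=
    fun θ => (hasSum_taylorCoeff hF (by simpa [abs_of_nonneg hr0] using hr1)).tsum_eq
  simpa only [hF'] using h

lemma MemHardy.summable_sq {F : ℂ → ℂ} (hF : MemHardy F) :
    Summable fun n => ‖taylorCoeff F n‖ ^ 2 := by
  obtain ⟨hd, C, hC⟩ := hF
  refine summable_of_sum_range_le (c := C) (fun n => by positivity) fun N => ?_
  have hlim : Tendsto (fun r : ℝ => ∑ n ∈ Finset.range N, ‖taylorCoeff F n‖ ^ 2 * r ^ (2 * n))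
      (𝓝[<] 1) (𝓝 (∑ n ∈ Finset.range N, ‖taylorCoeff F n‖ ^ 2)) := by
    have : Continuous fun r : ℝ =>
        ∑ n ∈ Finset.range N, ‖taylorCoeff F n‖ ^ 2 * r ^ (2 * n) := by fun_prop
    simpa using (this.tendsto 1).mono_left nhdsWithin_le_nhds
  refine le_of_tendsto hlim ?_
  filter_upwards [Ioo_mem_nhdsLT (zero_lt_one (α := ℝ))] with r hr
  have h := hasSum_sq_taylorCoeff hd hr.1.le hr.2
  exact (sum_le_hasSum _ (fun n _ => mul_nonneg (by positivity) (pow_nonneg hr.1.le _)) h).trans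
    (hC r hr)

lemma circleMap_mem_ball {r : ℝ} (hr0 : 0 ≤ r) (hr1 : r < 1) (θ : ℝ) :
    circleMap 0 r θ ∈ ball (0 : ℂ) 1 := by
  simpa [abs_of_nonneg hr0] using hr1

lemma tendsto_circleMap_radial (θ : ℝ) : Tendsto (fun r : ℝ => circleMap 0 r θ) (𝓝[<] 1)
    (𝓝[closedBall 0 1] (circleMap 0 1 θ)) := by
  refine tendsto_nhdsWithin_iff.2 ⟨?_, ?_⟩
  · have : Continuous fun r : ℝ => circleMap 0 r θ := by
      unfold circleMap; fun_prop
    exact (this.tendsto 1).mono_left nhdsWithin_le_nhds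
  · filter_upwards [Ioo_mem_nhdsLT (zero_lt_one (α := ℝ))] with r hr
    exact ball_subset_closedBall (circleMap_mem_ball hr.1.le hr.2 θ)

/-! ### Radial limits of the derivative at points of differentiability of the boundary function -/

lemma deriv_eq_circleAverage {f : ℂ → ℂ} (hf : DiffContOnCl ℂ f (ball 0 1)) {w : ℂ}
    (hw : w ∈ ball (0 : ℂ) 1) :
    deriv f w = circleAverage (fun z => z / (z - w) ^ 2 * f z) 0 1 := by
  have hcont : ContinuousOn f (sphere 0 1) :=
    hf.continuousOn_ball.mono sphere_subset_closedBall
  have hci : CircleIntegrable f 0 1 := hcont.circleIntegrable zero_le_one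
  have hrep : ∀ v ∈ ball (0 : ℂ) 1,
      circleAverage (fun z => herglotzRieszKernel 0 v z • f z) 0 1 = 2 * f v - f 0 := by
    intro v hv
    have hne : ∀ z ∈ sphere (0 : ℂ) 1, z - v ≠ 0 := by
      intro z hz h
      rw [sub_eq_zero] at h
      subst h
      simp at hv hz
      linarith
    have h1 : circleAverage (fun z => (z / (z - v)) • f z) 0 1 = f v := by
      have := DiffContOnCl.circleAverage_smul_div (c := (0 : ℂ)) (R := 1) (w := v) (f := f)
        (by simpa using hf) (by simpa using hv)
      simpa using this
    have h0 : circleAverage f 0 1 = f 0 := DiffContOnCl.circleAverage (by simpa using hf)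
    rw [← h1, ← h0, ← smul_eq_mul, ← circleAverage_fun_smul, ← circleAverage_fun_sub ?_ hci]
    · refine circleAverage_congr_sphere fun z hz => ?_
      have := hne z (by simpa using hz)
      simp only [herglotzRieszKernel_def, smul_eq_mul, sub_zero]
      field_simp
      ring
    · refine ContinuousOn.circleIntegrable zero_le_one ?_
      fun_prop (disch := assumption)
  have hd := hasDerivAt_circleAverage_herglotzRieszKernel_smul hci hw
  have hd' : HasDerivAt (fun v => 2 * f v - f 0)
      (circleAverage (fun ζ => (2 * ζ / (ζ - w) ^ 2) • f ζ) 0 1) w :=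
    hd.congr_of_eventuallyEq (by
      filter_upwards [isOpen_ball.mem_nhds hw] with v hv using (hrep v hv).symm)
  have hfd := (hf.differentiableAt isOpen_ball hw).hasDerivAt
  have h2 := hd'.unique ((hfd.const_mul 2).sub_const (f 0))
  have h3 : circleAverage (fun ζ => (2 * ζ / (ζ - w) ^ 2) • f ζ) 0 1 =
      2 * circleAverage (fun z => z / (z - w) ^ 2 * f z) 0 1 := by
    rw [← smul_eq_mul, ← circleAverage_fun_smul]
    congr 1
    ext z
    simp only [smul_eq_mul]; ring
  rw [h3] at h2
  exact (mul_left_cancel₀ two_ne_zero h2).symm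

lemma circleAverage_eq_zero_of_one_lt {f : ℂ → ℂ} (hf : DiffContOnCl ℂ f (ball 0 1)) {w : ℂ}
    (hw : 1 < ‖w‖) : circleAverage (fun z => z / (z - w) ^ 2 * f z) 0 1 = 0 := by
  have hne : ∀ z ∈ closedBall (0 : ℂ) 1, (z - w) ^ 2 ≠ 0 := by
    intro z hz h
    rw [pow_eq_zero_iff two_ne_zero, sub_eq_zero] at h
    subst h
    simp at hz
    linarith
  have hk : DiffContOnCl ℂ (fun z => z / (z - w) ^ 2) (ball 0 1) := by
    refine DifferentiableOn.diffContOnCl ?_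
    rw [closure_ball _ one_ne_zero]
    fun_prop (disch := assumption)
  have := DiffContOnCl.circleAverage (c := (0 : ℂ)) (R := 1) (f := fun z => z / (z - w) ^ 2 * f z)
    (by simpa using hk.smul hf)
  simpa using this

lemma continuousOn_poissonKernel {z : ℂ} (hz : z ∈ ball (0 : ℂ) 1) :
    ContinuousOn (poissonKernel 0 z) (sphere 0 1) := by
  rw [poissonKernel_eq_re_herglotzRieszKernel]
  have := continuousOn_herglotzRieszKernel_sphere hz
  rw [abs_one] at this
  exact Complex.continuous_re.comp_continuousOn this

lemma circleAverage_poissonKernel {w : ℂ} (hw : w ∈ ball (0 : ℂ) 1) :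
    circleAverage (poissonKernel 0 w) 0 1 = 1 := by
  have := InnerProductSpace.HarmonicOnNhd.circleAverage_poissonKernel_smul (c := 0) (R := 1)
    (f := fun _ : ℂ => (1 : ℝ)) (fun z _ => InnerProductSpace.harmonicAt_const _) hw
  rwa [show (poissonKernel 0 w • fun _ : ℂ => (1 : ℝ)) = poissonKernel 0 w by
    ext z; simp] at this

/-- The kernels of Cauchy's formula for the derivative at `rζ` and at the reflected point `ζ/r`
differ by at most `9(1-r)/|w-rζ|³` on the unit circle, so that their difference is dominated by the
Poisson kernel when paired with a function that is `o(|w-ζ|)` at `ζ`. -/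
lemma norm_kernel_sub_mul_le {ζ w q : ℂ} {r ε K : ℝ} (hζ : ‖ζ‖ = 1) (hw : ‖w‖ = 1)
    (hr : 1 / 2 ≤ r) (hr1 : r < 1) (hε : 0 ≤ ε) (hK : 0 ≤ K)
    (hq : ‖q‖ ≤ ε * ‖w - ζ‖ + K * ‖w - ζ‖ ^ 3) :
    ‖w / (w - r * ζ) ^ 2 * q - w / (w - ζ / r) ^ 2 * q‖ ≤
      18 * ε * poissonKernel 0 (r * ζ) w + 72 * K * (1 - r) := by
  have hr0 : 0 < r := by linarith
  have hrC : (r : ℂ) ≠ 0 := by exact_mod_cast hr0.ne'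
  set ρ := ‖w - r * ζ‖ with hρ
  have hnrζ : ‖(r : ℂ) * ζ‖ = r := by simp [hζ, abs_of_pos hr0]
  have hsρ : 1 - r ≤ ρ := by
    have := norm_sub_norm_le w (r * ζ)
    rw [hw, hnrζ] at this
    exact this
  have hρ0 : 0 < ρ := by linarith
  have hd : ‖w - ζ‖ ≤ 2 * ρ := by
    have h1 : ‖(r : ℂ) * ζ - ζ‖ = 1 - r := by
      rw [show (r : ℂ) * ζ - ζ = ((r - 1 : ℝ) : ℂ) * ζ by push_cast; ring, norm_mul, hζ,
        Complex.norm_real, mul_one, norm_eq_abs, abs_of_neg (by linarith)]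
      ring
    have := norm_sub_le_norm_sub_add_norm_sub w (r * ζ) ζ
    linarith
  -- `w` and `ζ` are unimodular, hence `|ζ - rw| = |w - rζ|`
  have hrefl : ‖w - ζ / r‖ = ρ / r := by
    have h1 : ‖r * w - ζ‖ = ρ := by
      rw [hρ, ← sq_eq_sq₀ (norm_nonneg _) (norm_nonneg _), ← Complex.normSq_eq_norm_sq,
        ← Complex.normSq_eq_norm_sq, Complex.normSq_sub, Complex.normSq_sub]
      simp only [map_mul, Complex.normSq_eq_norm_sq, hζ, hw,
        Complex.mul_re, Complex.mul_im, Complex.conj_re, Complex.conj_im, Complex.ofReal_re,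
        Complex.ofReal_im]
      ring
    rw [show w - ζ / r = (r * w - ζ) / r by field_simp, norm_div, h1, Complex.norm_real,
      norm_of_nonneg hr0.le]
  have hne1 : w - r * ζ ≠ 0 := norm_pos_iff.1 hρ0
  have hne2 : w - ζ / r ≠ 0 := norm_pos_iff.1 (by rw [hrefl]; positivity)
  have hρr : ρ ≤ ρ / r := by
    rw [le_div_iff₀ hr0]; nlinarith
  have hρr2 : ρ / r ≤ 2 * ρ := by
    rw [div_le_iff₀ hr0]; nlinarith
  have hA : ‖(r : ℂ) * ζ - ζ / r‖ ≤ 3 * (1 - r) := by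
    rw [show (r : ℂ) * ζ - ζ / r = ((r - 1 / r : ℝ) : ℂ) * ζ by push_cast; ring, norm_mul, hζ,
      Complex.norm_real, mul_one, norm_eq_abs, abs_le]
    have : 1 / r ≤ 3 - 2 * r := by
      rw [div_le_iff₀ hr0]; nlinarith
    have : 1 ≤ 1 / r := by rw [le_div_iff₀ hr0]; linarith
    constructor <;> linarith
  have hB : ‖(w - r * ζ) + (w - ζ / r)‖ ≤ 3 * ρ := by
    have := norm_add_le (w - r * ζ) (w - ζ / r)
    rw [hrefl] at this
    linarith
  have hkey : w / (w - r * ζ) ^ 2 * q - w / (w - ζ / r) ^ 2 * q =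
      w * (((r * ζ - ζ / r) * ((w - r * ζ) + (w - ζ / r))) /
        ((w - r * ζ) ^ 2 * (w - ζ / r) ^ 2)) * q := by
    rw [show (r : ℂ) * ζ - ζ / r = (w - ζ / r) - (w - r * ζ) by ring]
    generalize w - r * ζ = u at hne1 ⊢
    generalize w - ζ / r = v at hne2 ⊢
    field_simp
    ring
  have hqρ : ‖q‖ ≤ 2 * ε * ρ + 8 * K * ρ ^ 3 := by
    have h3 : ‖w - ζ‖ ^ 3 ≤ (2 * ρ) ^ 3 := by gcongr
    have h4 := mul_le_mul_of_nonneg_left h3 hK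
    have h5 := mul_le_mul_of_nonneg_left hd hε
    nlinarith
  have hpk : (1 - r) / ρ ^ 2 ≤ poissonKernel 0 (r * ζ) w := by
    rw [poissonKernel_def]
    simp only [sub_zero, hw, hnrζ, ← hρ]
    have : r ^ 2 ≤ r := by nlinarith
    gcongr
    linarith
  rw [hkey, norm_mul, norm_mul, hw, one_mul, norm_div, norm_mul, norm_mul, norm_pow, norm_pow,
    ← hρ, hrefl]
  calc _ ≤ (3 * (1 - r)) * (3 * ρ) / (ρ ^ 2 * ρ ^ 2) * (2 * ε * ρ + 8 * K * ρ ^ 3) := by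
        gcongr
    _ = 18 * ε * ((1 - r) / ρ ^ 2) + 72 * K * (1 - r) := by
        field_simp
        ring
    _ ≤ _ := by gcongr

/-- A boundary function that is differentiable at `θ` is approximated by its tangent, up to a
cubic error that accounts for the points of the circle away from `e^{iθ}`. -/
lemma exists_norm_sub_tangent_le {P : ℂ → ℂ} (hP : ContinuousOn P (sphere 0 1)) {θ : ℝ} {D : ℂ}
    (hD : HasDerivAt (fun t : ℝ => P (circleMap 0 1 t)) (D * (circleMap 0 1 θ * Complex.I)) θ)
    {ε : ℝ} (hε : 0 < ε) :
    ∃ K : ℝ, 0 ≤ K ∧ ∀ w : ℂ, ‖w‖ = 1 →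
      ‖P w - P (circleMap 0 1 θ) - D * (w - circleMap 0 1 θ)‖ ≤
        ε * ‖w - circleMap 0 1 θ‖ + K * ‖w - circleMap 0 1 θ‖ ^ 3 := by
  set ζ := circleMap 0 1 θ with hζ
  have hζ1 : ‖ζ‖ = 1 := by simp [ζ]
  have hζ0 : ζ ≠ 0 := norm_pos_iff.1 (by rw [hζ1]; exact one_pos)
  have hq : HasDerivAt
      (fun t : ℝ => P (circleMap 0 1 t) - P ζ - D * (circleMap 0 1 t - ζ)) 0 θ := by
    have := ((hD.sub_const (P ζ)).sub (((hasDerivAt_circleMap 0 1 θ).sub_const ζ).const_mul D))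
    simpa [← hζ, Pi.sub_def] using this
  have ho := hq.isLittleO.bound (c := ε * (2 / π)) (by positivity)
  obtain ⟨η, hη, hball⟩ := Metric.eventually_nhds_iff.1 ho
  obtain ⟨B, hB⟩ := ((isCompact_sphere (0 : ℂ) 1).bddAbove_image
    (f := fun w => ‖P w - P ζ - D * (w - ζ)‖) (by fun_prop))
  have hBw : ∀ w : ℂ, ‖w‖ = 1 → ‖P w - P ζ - D * (w - ζ)‖ ≤ B := fun w hw =>
    hB ⟨w, by simpa using hw, rfl⟩
  have hB0 : 0 ≤ B := (norm_nonneg _).trans (hBw ζ hζ1)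
  refine ⟨B / (2 / π * η) ^ 3, by positivity, fun w hw => ?_⟩
  set x := Complex.arg (w / ζ) with hx
  have hwx : w = circleMap 0 1 (θ + x) := by
    have h1 : ‖w / ζ‖ = 1 := by rw [norm_div, hw, hζ1, div_one]
    have h2 := Complex.norm_mul_exp_arg_mul_I (w / ζ)
    rw [h1, ← hx, Complex.ofReal_one, one_mul, eq_div_iff hζ0] at h2
    rw [← h2, hζ]
    simp only [circleMap, Complex.ofReal_add, add_mul, Complex.exp_add]
    ring
  have hdist : 2 / π * |x| ≤ ‖w - ζ‖ := by
    have h1 : w - ζ = ζ * (Complex.exp (Complex.I * x) - 1) := by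
      rw [hwx, hζ, mul_comm Complex.I]
      simp only [circleMap, Complex.ofReal_add, add_mul, Complex.exp_add]
      ring
    rw [h1, norm_mul, hζ1, one_mul, Complex.norm_exp_I_mul_ofReal_sub_one, norm_mul,
      norm_eq_abs, norm_eq_abs, abs_two]
    have := mul_abs_le_abs_sin (x := x / 2) (by
      rw [abs_div, abs_two]
      gcongr
      exact Complex.abs_arg_le_pi _)
    rw [abs_div, abs_two] at this
    linarith
  by_cases hxη : |x| < η
  · have h1 := hball (y := θ + x) (by simpa [dist_eq_norm] using hxη)
    simp only [← hwx, ← hζ, sub_self, mul_zero, sub_zero, smul_zero, add_sub_cancel_left,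
      norm_eq_abs] at h1
    calc _ ≤ ε * (2 / π) * |x| := h1
      _ = ε * (2 / π * |x|) := by ring
      _ ≤ ε * ‖w - ζ‖ := by gcongr
      _ ≤ _ := le_add_of_nonneg_right (by positivity)
  · have h1 : 2 / π * η ≤ ‖w - ζ‖ := le_trans (by gcongr; exact not_lt.1 hxη) hdist
    calc _ ≤ B := hBw w hw
      _ = B / (2 / π * η) ^ 3 * (2 / π * η) ^ 3 := by field_simp
      _ ≤ B / (2 / π * η) ^ 3 * ‖w - ζ‖ ^ 3 := by gcongr
      _ ≤ _ := le_add_of_nonneg_left (by positivity)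

/-- **Fatou's theorem** for derivatives: where the boundary function of `P` is differentiable in
the angle, `P'` has the corresponding radial limit. -/
lemma tendsto_deriv_radial {P : ℂ → ℂ} (hP : DiffContOnCl ℂ P (ball 0 1)) {θ : ℝ} {D : ℂ}
    (hD : HasDerivAt (fun t : ℝ => P (circleMap 0 1 t)) (D * (circleMap 0 1 θ * Complex.I)) θ) :
    Tendsto (fun r : ℝ => deriv P (circleMap 0 r θ)) (𝓝[<] 1) (𝓝 D) := by
  have hPs : ContinuousOn P (sphere 0 1) :=
    hP.continuousOn_ball.mono sphere_subset_closedBall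
  set ζ := circleMap 0 1 θ with hζ
  have hζ1 : ‖ζ‖ = 1 := by simp [ζ]
  rw [Metric.tendsto_nhds]
  intro e he
  -- half of `e` is left for the term with `K`, as `18 * (e / 36) = e / 2`
  obtain ⟨K, hK, hbound⟩ := exists_norm_sub_tangent_le hPs hD (ε := e / 36) (by positivity)
  have hev : ∀ᶠ r : ℝ in 𝓝[<] 1, 72 * K * (1 - r) < e / 2 := by
    have : Tendsto (fun r : ℝ => 72 * K * (1 - r)) (𝓝[<] 1) (𝓝 0) := by
      have : Continuous fun r : ℝ => 72 * K * (1 - r) := by fun_prop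
      simpa using (this.tendsto 1).mono_left nhdsWithin_le_nhds
    exact this.eventually_lt_const (by positivity)
  filter_upwards [hev, Ioo_mem_nhdsLT (show (1 / 2 : ℝ) < 1 by norm_num)] with r hr hr1
  have hr0 : 0 < r := by linarith [hr1.1]
  set Q : ℂ → ℂ := fun w => P w - P ζ - D * (w - ζ) with hQ
  have hQd : DiffContOnCl ℂ Q (ball 0 1) := by
    refine (hP.sub_const (P ζ)).sub ?_
    exact Differentiable.diffContOnCl (by fun_prop)
  have hz : (r : ℂ) * ζ ∈ ball (0 : ℂ) 1 := by
    simpa [hζ1, abs_of_pos hr0] using hr1.2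
  have hz' : 1 < ‖ζ / r‖ := by
    rw [norm_div, hζ1, Complex.norm_real, norm_of_nonneg hr0.le]
    exact one_lt_one_div hr0 hr1.2
  have hderiv : deriv Q (r * ζ) = deriv P (r * ζ) - D := by
    have h1 := (hP.differentiableAt isOpen_ball hz).hasDerivAt
    have h2 := (h1.sub_const (P ζ)).sub
      (((hasDerivAt_id (r * ζ)).sub_const ζ).const_mul D)
    simpa [hQ, Pi.sub_def] using h2.deriv
  have hQs : ContinuousOn Q (sphere 0 1) :=
    hQd.continuousOn_ball.mono sphere_subset_closedBall
  have hne1 : ∀ w ∈ sphere (0 : ℂ) 1, (w - r * ζ) ^ 2 ≠ 0 := by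
    intro w hw h
    rw [pow_eq_zero_iff two_ne_zero, sub_eq_zero] at h
    subst h
    simp only [mem_sphere, mem_ball] at hw hz
    linarith
  have hne2 : ∀ w ∈ sphere (0 : ℂ) 1, (w - ζ / r) ^ 2 ≠ 0 := by
    intro w hw h
    rw [pow_eq_zero_iff two_ne_zero, sub_eq_zero] at h
    subst h
    simp only [mem_sphere, dist_zero_right] at hw
    linarith
  have hrep : deriv P (r * ζ) - D = circleAverage
      (fun w => w / (w - r * ζ) ^ 2 * Q w - w / (w - ζ / r) ^ 2 * Q w) 0 1 := by
    rw [← hderiv, circleAverage_fun_sub, ← deriv_eq_circleAverage hQd hz,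
      circleAverage_eq_zero_of_one_lt hQd hz', sub_zero]
    · refine ContinuousOn.circleIntegrable zero_le_one ?_
      fun_prop (disch := assumption)
    · refine ContinuousOn.circleIntegrable zero_le_one ?_
      fun_prop (disch := assumption)
  have hpci : CircleIntegrable (poissonKernel 0 (r * ζ)) 0 1 :=
    (continuousOn_poissonKernel hz).circleIntegrable zero_le_one
  have hle : ‖deriv P (r * ζ) - D‖ ≤
      circleAverage (fun w => 18 * (e / 36) * poissonKernel 0 (r * ζ) w + 72 * K * (1 - r)) 0 1 := by
    rw [hrep, circleAverage_def, circleAverage_def, norm_smul, smul_eq_mul,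
      norm_of_nonneg (by positivity)]
    gcongr
    refine intervalIntegral.norm_integral_le_of_norm_le (by positivity)
      (ae_of_all _ fun t _ => ?_) ?_
    · exact norm_kernel_sub_mul_le hζ1 (by simp) hr1.1.le hr1.2 (by positivity) hK
        (hbound _ (by simp))
    · exact (IntervalIntegrable.const_mul hpci _).add (by simp)
  have hav : circleAverage
      (fun w => 18 * (e / 36) * poissonKernel 0 (r * ζ) w + 72 * K * (1 - r)) 0 1 =
        18 * (e / 36) + 72 * K * (1 - r) := by
    have hci : CircleIntegrable (fun w => 18 * (e / 36) * poissonKernel 0 (r * ζ) w) 0 1 :=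
      IntervalIntegrable.const_mul hpci _
    rw [circleAverage_fun_add hci (circleIntegrable_const _ _ _), circleAverage_const]
    simp_rw [← smul_eq_mul (18 * (e / 36))]
    rw [circleAverage_fun_smul, circleAverage_poissonKernel hz, smul_eq_mul, mul_one]
  rw [hav] at hle
  rw [dist_eq_norm, circleMap_zero_eq_mul]
  linarith

/-! ### Boundary values and the norm of the Hardy space -/

/-- The character `t ↦ e^{int}` as an element of `L²(0, 2π)`, normalized to be a unit vector. -/
def unitCharacter (n : ℕ) : Lp ℂ 2 (volume.restrict (Ioc (0 : ℝ) (2 * π))) :=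
  MemLp.toLp (fun t : ℝ => ((√(2 * π) : ℝ) : ℂ)⁻¹ * circleMap 0 1 t ^ n)
    (MemLp.of_bound (Continuous.aestronglyMeasurable (by fun_prop)) (√(2 * π))⁻¹
      (ae_of_all _ fun t => by simp [abs_of_nonneg (Real.sqrt_nonneg _)]))

lemma coeFn_unitCharacter (n : ℕ) :
    unitCharacter n =ᵐ[volume.restrict (Ioc (0 : ℝ) (2 * π))]
      fun t : ℝ => ((√(2 * π) : ℝ) : ℂ)⁻¹ * circleMap 0 1 t ^ n :=
  MemLp.coeFn_toLp _

lemma orthonormal_unitCharacter : Orthonormal ℂ unitCharacter := by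
  rw [orthonormal_iff_ite]
  intro m n
  have h : inner ℂ (unitCharacter m) (unitCharacter n) =
      ∫ t in (0 : ℝ)..(2 * π),
        (2 * π : ℂ)⁻¹ * (circleMap 0 1 t ^ n * conj (circleMap 0 1 t ^ m)) := by
    rw [L2.inner_def, intervalIntegral.integral_of_le (by positivity)]
    refine integral_congr_ae ?_
    filter_upwards [coeFn_unitCharacter m, coeFn_unitCharacter n] with t hm hn
    rw [hm, hn]
    have h2 : ((√(2 * π) : ℝ) : ℂ)⁻¹ * ((√(2 * π) : ℝ) : ℂ)⁻¹ = (2 * π : ℂ)⁻¹ := by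
      rw [← mul_inv, ← Complex.ofReal_mul, Real.mul_self_sqrt (by positivity)]
      push_cast; rfl
    rw [← h2]
    simp only [RCLike.inner_apply, map_mul, map_inv₀, Complex.conj_ofReal]
    ring
  rw [h, intervalIntegral.integral_const_mul, integral_circleMap_pow_mul_conj]
  have : (2 * π : ℂ) ≠ 0 := by
    exact_mod_cast (by positivity : (2 * π : ℝ) ≠ 0)
  by_cases hmn : m = n
  · subst hmn
    simp only [if_true]
    push_cast
    exact inv_mul_cancel₀ this
  · simp [hmn, Ne.symm hmn]

/-- Riesz–Fischer: a square summable sequence of coefficients is the sequence of Fourier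
coefficients of a square integrable function, whose primitive is obtained by termwise
integration. -/
lemma exists_intervalIntegrable_hasSum {d : ℕ → ℂ} (hd : Summable fun n => ‖d n‖ ^ 2) :
    ∃ G : ℝ → ℂ, IntervalIntegrable G volume 0 (2 * π) ∧
      HasSum (fun n => ‖d n‖ ^ 2) (1 / (2 * π) * ∫ t in (0 : ℝ)..(2 * π), ‖G t‖ ^ 2) ∧
      ∀ x ∈ Icc 0 (2 * π),
        HasSum (fun n => d n * ∫ t in (0 : ℝ)..x, circleMap 0 1 t ^ n) (∫ t in (0 : ℝ)..x, G t) := by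
  have hmem : Memℓp (fun n => ((√(2 * π) : ℝ) : ℂ) * d n) 2 := by
    refine memℓp_gen ?_
    simp only [ENNReal.toReal_ofNat, rpow_two, norm_mul, mul_pow]
    exact hd.mul_left _
  set f : lp (fun _ : ℕ => ℂ) 2 := ⟨_, hmem⟩ with hf
  set V := orthonormal_unitCharacter.orthogonalFamily with hV
  set F := V.linearIsometry f with hF
  have hsum : HasSum (fun n => (((√(2 * π) : ℝ) : ℂ) * d n) • unitCharacter n) F :=
    V.hasSum_linearIsometry f
  have hnorm : HasSum (fun n => 2 * π * ‖d n‖ ^ 2) (‖F‖ ^ 2) := by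
    have h1 := lp.hasSum_norm (p := 2) (by norm_num) f
    rw [hF, V.linearIsometry.norm_map]
    simp only [ENNReal.toReal_ofNat, rpow_two] at h1
    refine h1.congr_fun fun n => ?_
    simp only [hf, norm_mul, mul_pow, Complex.norm_real, norm_eq_abs, sq_abs]
    rw [Real.sq_sqrt (by positivity)]
  have hnormint : ‖F‖ ^ 2 = ∫ t in (0 : ℝ)..(2 * π), ‖F t‖ ^ 2 := by
    have h1 : ((‖F‖ ^ 2 : ℝ) : ℂ) = inner ℂ F F := by
      rw [inner_self_eq_norm_sq_to_K]; push_cast; rfl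
    rw [L2.inner_def] at h1
    rw [intervalIntegral.integral_of_le (by positivity), ← Complex.ofReal_inj, h1,
      ← integral_complex_ofReal]
    refine integral_congr_ae (ae_of_all _ fun t => ?_)
    simp only [inner_self_eq_norm_sq_to_K]
    push_cast; rfl
  have hLp := Lp.memLp F
  have hint : IntervalIntegrable F volume 0 (2 * π) := by
    rw [intervalIntegrable_iff_integrableOn_Ioc_of_le (by positivity)]
    exact hLp.integrable (by norm_num)
  refine ⟨F, hint, ?_, fun x hx => ?_⟩
  · rw [← hnormint]
    refine (hnorm.mul_left (1 / (2 * π))).congr_fun fun n => ?_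
    field_simp
  · have hset : MeasurableSet (Ioc (0 : ℝ) x) := measurableSet_Ioc
    have hfin : (volume.restrict (Ioc (0 : ℝ) (2 * π))) (Ioc (0 : ℝ) x) ≠ ⊤ :=
      measure_ne_top _ _
    have hrestr : (volume.restrict (Ioc (0 : ℝ) (2 * π))).restrict (Ioc (0 : ℝ) x) =
        volume.restrict (Ioc (0 : ℝ) x) := by
      rw [Measure.restrict_restrict hset]
      congr 1
      exact inter_eq_left.2 (Ioc_subset_Ioc_right hx.2)
    have hval : ∀ g : Lp ℂ 2 (volume.restrict (Ioc (0 : ℝ) (2 * π))),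
        inner ℂ (indicatorConstLp 2 hset hfin (1 : ℂ)) g = ∫ t in (0 : ℝ)..x, g t := by
      intro g
      rw [L2.inner_indicatorConstLp_one, hrestr, intervalIntegral.integral_of_le hx.1]
    have h1 := hsum.mapL (innerSL ℂ (indicatorConstLp 2 hset hfin (1 : ℂ)))
    rw [innerSL_apply_apply, hval] at h1
    refine h1.congr_fun fun n => ?_
    rw [innerSL_apply_apply, inner_smul_right, hval]
    have h2 : ∫ t in (0 : ℝ)..x, unitCharacter n t =
        ((√(2 * π) : ℝ) : ℂ)⁻¹ * ∫ t in (0 : ℝ)..x, circleMap 0 1 t ^ n := by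
      rw [← intervalIntegral.integral_const_mul, intervalIntegral.integral_of_le hx.1,
        intervalIntegral.integral_of_le hx.1]
      refine integral_congr_ae ?_
      rw [← hrestr]
      exact ae_restrict_of_ae (coeFn_unitCharacter n)
    rw [h2]
    have : ((√(2 * π) : ℝ) : ℂ) ≠ 0 := by
      exact_mod_cast (by positivity : √(2 * π) ≠ 0)
    field_simp

lemma summable_norm_div_succ {c : ℕ → ℂ} (hc : Summable fun n => ‖c n‖ ^ 2) :
    Summable fun n => ‖c n / (n + 1)‖ := by
  have h1 : Summable fun n : ℕ => (1 / ((n : ℝ) + 1)) ^ 2 := by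
    have := (summable_nat_add_iff 1).2 (Real.summable_one_div_nat_pow.2 one_lt_two)
    refine this.congr fun n => ?_
    push_cast; rw [div_pow, one_pow]
  refine Summable.of_nonneg_of_le (fun n => norm_nonneg _) (fun n => ?_) (hc.add h1)
  have h2 : ‖c n / (n + 1)‖ = ‖c n‖ * (1 / ((n : ℝ) + 1)) := by
    rw [norm_div, show ((n : ℂ) + 1) = (((n : ℝ) + 1 : ℝ) : ℂ) by push_cast; rfl,
      Complex.norm_real, norm_of_nonneg (by positivity)]
    ring
  rw [h2]
  nlinarith [sq_nonneg (‖c n‖ - 1 / ((n : ℝ) + 1)), sq_nonneg (‖c n‖),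
    sq_nonneg (1 / ((n : ℝ) + 1))]

/-- The coefficients of the primitive vanishing at the origin. -/
def primitiveCoeff (c : ℕ → ℂ) : ℕ → ℂ
  | 0 => 0
  | n + 1 => c n / (n + 1)

lemma summable_norm_primitiveCoeff {c : ℕ → ℂ} (hc : Summable fun n => ‖c n‖ ^ 2) :
    Summable fun n => ‖primitiveCoeff c n‖ :=
  (summable_nat_add_iff 1).1 (summable_norm_div_succ hc)

lemma deriv_powerSum_primitiveCoeff {F : ℂ → ℂ} (hF : MemHardy F) {z : ℂ} (hz : ‖z‖ < 1) :
    deriv (powerSum (primitiveCoeff (taylorCoeff F))) z = F z := by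
  have hs := summable_norm_primitiveCoeff hF.summable_sq
  have H := Complex.hasSum_deriv_of_summable_norm (U := ball (0 : ℂ) 1)
    (F := fun n z => primitiveCoeff (taylorCoeff F) n * z ^ n) hs
    (fun n => by fun_prop) isOpen_ball
    (fun n w hw => norm_mul_pow_le (by simpa using (mem_ball.1 hw).le))
    (show z ∈ ball (0 : ℂ) 1 by simpa using hz)
  have H' := (hasSum_nat_add_iff' 1).2 H
  simp only [Finset.range_one, Finset.sum_singleton, primitiveCoeff, zero_mul, deriv_const,
    sub_zero] at H'
  refine H'.unique ((hasSum_taylorCoeff hF.1 hz).congr_fun fun n => ?_)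
  have : (n : ℂ) + 1 ≠ 0 := by exact_mod_cast n.succ_ne_zero
  simp
  field_simp

/-- **Fatou's theorem** in the Hardy space, with the norm identity that it implies. -/
lemma MemHardy.hasSum_sq {F : ℂ → ℂ} (hF : MemHardy F) :
    HasSum (fun n => ‖taylorCoeff F n‖ ^ 2) (hardyNorm F ^ 2) := by
  set c := taylorCoeff F with hc
  have hs := summable_norm_primitiveCoeff hF.summable_sq
  set P := powerSum (primitiveCoeff c) with hP
  -- the shift accounts for the factor `e^{it}` in the angular derivative of the primitive
  set d : ℕ → ℂ := fun n => Nat.casesOn n 0 c with hd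
  have hd2 : Summable fun n => ‖d n‖ ^ 2 := (summable_nat_add_iff 1).1 hF.summable_sq
  obtain ⟨G, hGint, hGnorm, hGprim⟩ := exists_intervalIntegrable_hasSum hd2
  have hprim : ∀ x ∈ Icc 0 (2 * π),
      P (circleMap 0 1 x) = P 1 + Complex.I * ∫ t in (0 : ℝ)..x, G t := by
    intro x hx
    have h1 := hasSum_powerSum hs (z := circleMap 0 1 x) (by simp)
    have h2 := hasSum_powerSum hs (z := 1) (by simp)
    have h3 := (hGprim x hx).mul_left Complex.I
    rw [add_comm, ← sub_eq_iff_eq_add]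
    refine (h1.sub h2).unique (h3.congr_fun fun n => ?_)
    rcases n with _ | n
    · simp [hd, primitiveCoeff]
    · have hn : (n : ℂ) + 1 ≠ 0 := by exact_mod_cast n.succ_ne_zero
      have hnI : ((n : ℂ) + 1) * Complex.I ≠ 0 := mul_ne_zero hn Complex.I_ne_zero
      have h4 : ∫ t in (0 : ℝ)..x, circleMap 0 1 t ^ (n + 1) =
          (circleMap 0 1 x ^ (n + 1) - 1) / (((n : ℂ) + 1) * Complex.I) := by
        simp_rw [circleMap_zero_one_pow]
        push_cast
        rw [integral_exp_mul_complex hnI]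
        simp
      rw [h4]
      simp only [hd, primitiveCoeff]
      field_simp
      ring
  have hlim : ∀ᵐ x ∂volume, x ∈ Ioc 0 (2 * π) → ‖boundaryValue F x‖ ^ 2 = ‖G x‖ ^ 2 := by
    filter_upwards [hGint.ae_hasDerivAt_integral, compl_mem_ae_iff.2 (measure_singleton (2 * π))]
      with x hx hx2 hxI
    have hx2' : x < 2 * π := lt_of_le_of_ne hxI.2 hx2
    rw [uIcc_of_le (by positivity)] at hx
    have h1 := hx ⟨hxI.1.le, hxI.2⟩ 0 ⟨le_rfl, by positivity⟩
    have hζ : circleMap 0 1 x ≠ 0 := circleMap_ne_center one_ne_zero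
    have h2 : HasDerivAt (fun t : ℝ => P (circleMap 0 1 t))
        ((G x / circleMap 0 1 x) * (circleMap 0 1 x * Complex.I)) x := by
      have h3 := (h1.const_mul Complex.I).const_add (P 1)
      rw [show (G x / circleMap 0 1 x) * (circleMap 0 1 x * Complex.I) = Complex.I * G x by
        field_simp]
      refine h3.congr_of_eventuallyEq ?_
      filter_upwards [Ioo_mem_nhds hxI.1 hx2'] with t ht using hprim t ⟨ht.1.le, ht.2.le⟩
    have h4 := tendsto_deriv_radial (diffContOnCl_powerSum hs) h2
    have h5 : Tendsto (fun r : ℝ => F (circleMap 0 r x)) (𝓝[<] 1)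
        (𝓝 (G x / circleMap 0 1 x)) := by
      refine h4.congr' ?_
      filter_upwards [Ioo_mem_nhdsLT (zero_lt_one (α := ℝ))] with r hr
      exact deriv_powerSum_primitiveCoeff hF (by simpa [abs_of_pos hr.1] using hr.2)
    rw [boundaryValue, h5.limUnder_eq, norm_div, norm_circleMap_zero, abs_one, div_one]
  have heq : hardyNorm F ^ 2 = 1 / (2 * π) * ∫ t in (0 : ℝ)..(2 * π), ‖G t‖ ^ 2 := by
    rw [hardyNorm, Real.sq_sqrt]
    · congr 1
      refine intervalIntegral.integral_congr_ae ?_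
      rwa [uIoc_of_le (by positivity)]
    · refine mul_nonneg (by positivity)
        (intervalIntegral.integral_nonneg (by positivity) fun t _ => by positivity)
  rw [heq]
  have := (hasSum_nat_add_iff' 1).2 hGnorm
  simpa [hd] using this

/-! ### Harmonic measure and the weighted estimate inside the disk -/

section HarmonicMeasure

/-- The analytic function in the unit disk whose real part is the harmonic measure of the part of
the unit circle that lies in `S`. -/
def harmonicMeasureCompletion (S : Set ℂ) (z : ℂ) : ℂ :=
  circleAverage (fun ζ => herglotzRieszKernel 0 z ζ • ((S.indicator 1 ζ : ℝ) : ℂ)) 0 1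

variable {S : Set ℂ}

lemma circleIntegrable_indicator_one (hS : IsClosed S) :
    CircleIntegrable (S.indicator (1 : ℂ → ℝ)) 0 1 := by
  refine (intervalIntegrable_const (c := (1 : ℝ))).mono_fun ?_ (ae_of_all _ fun θ => ?_)
  · exact ((measurable_one.indicator hS.measurableSet).comp
      (continuous_circleMap 0 1).measurable).aestronglyMeasurable
  · by_cases h : circleMap 0 1 θ ∈ S <;> simp [h]

lemma indicator_one_mem_Icc (z : ℂ) : S.indicator (1 : ℂ → ℝ) z ∈ Icc (0 : ℝ) 1 := by
  by_cases h : z ∈ S <;> simp [h]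

lemma differentiableOn_harmonicMeasureCompletion (hS : IsClosed S) :
    DifferentiableOn ℂ (harmonicMeasureCompletion S) (ball 0 1) := by
  refine differentiableOn_circleAverage_herglotzRieszKernel_smul ?_
  have := circleIntegrable_indicator_one hS
  simp only [CircleIntegrable, intervalIntegrable_iff] at this ⊢
  exact Complex.ofRealCLM.integrable_comp this

lemma re_harmonicMeasureCompletion (hS : IsClosed S) {z : ℂ} (hz : z ∈ ball (0 : ℂ) 1) :
    (harmonicMeasureCompletion S z).re =
      circleAverage (fun ζ => poissonKernel 0 z ζ * S.indicator 1 ζ) 0 1 := by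
  rw [harmonicMeasureCompletion,
    re_circleAverage_herglotzRieszKernel_smul (circleIntegrable_indicator_one hS) hz,
    ← poissonKernel_eq_re_herglotzRieszKernel]
  rfl

lemma circleIntegrable_poissonKernel_mul_indicator (hS : IsClosed S) {z : ℂ}
    (hz : z ∈ ball (0 : ℂ) 1) :
    CircleIntegrable (fun ζ => poissonKernel 0 z ζ * S.indicator 1 ζ) 0 1 :=
  (circleIntegrable_indicator_one hS).continuousOn_smul (by
    rw [abs_one]; exact continuousOn_poissonKernel hz)

lemma le_poissonKernel {z ζ : ℂ} (hz : z ∈ ball (0 : ℂ) 1) (hζ : ζ ∈ sphere (0 : ℂ) 1) :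
    (1 - ‖z‖) / (1 + ‖z‖) ≤ poissonKernel 0 z ζ := by
  rw [poissonKernel_eq_re_herglotzRieszKernel]
  simpa [herglotzRieszKernel_def] using le_re_herglotzRieszKernel hζ hz

lemma poissonKernel_nonneg {z ζ : ℂ} (hz : z ∈ ball (0 : ℂ) 1) (hζ : ζ ∈ sphere (0 : ℂ) 1) :
    0 ≤ poissonKernel 0 z ζ := by
  refine le_trans ?_ (le_poissonKernel hz hζ)
  rw [mem_ball, dist_zero_right] at hz
  exact div_nonneg (by linarith) (by positivity)

/-- Harnack's lower bound for the harmonic measure. -/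
lemma le_re_harmonicMeasureCompletion (hS : IsClosed S) {z : ℂ} (hz : z ∈ ball (0 : ℂ) 1) :
    (1 - ‖z‖) / (1 + ‖z‖) * circleAverage (S.indicator 1) 0 1 ≤
      (harmonicMeasureCompletion S z).re := by
  rw [re_harmonicMeasureCompletion hS hz, ← smul_eq_mul, ← circleAverage_fun_smul]
  refine circleAverage_mono ((circleIntegrable_indicator_one hS).const_smul)
    (circleIntegrable_poissonKernel_mul_indicator hS hz) fun ζ hζ => ?_
  rw [abs_one] at hζ
  exact mul_le_mul_of_nonneg_right (le_poissonKernel hz hζ) (indicator_one_mem_Icc ζ).1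

lemma re_harmonicMeasureCompletion_le_one (hS : IsClosed S) {z : ℂ} (hz : z ∈ ball (0 : ℂ) 1) :
    (harmonicMeasureCompletion S z).re ≤ 1 := by
  rw [re_harmonicMeasureCompletion hS hz]
  conv_rhs => rw [← circleAverage_poissonKernel hz]
  refine circleAverage_mono (R := 1) (circleIntegrable_poissonKernel_mul_indicator hS hz)
    ((continuousOn_poissonKernel hz).circleIntegrable zero_le_one) fun ζ hζ => ?_
  rw [abs_one] at hζ
  exact mul_le_of_le_one_right (poissonKernel_nonneg hz hζ) (indicator_one_mem_Icc ζ).2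

lemma re_harmonicMeasureCompletion_nonneg (hS : IsClosed S) {z : ℂ} (hz : z ∈ ball (0 : ℂ) 1) :
    0 ≤ (harmonicMeasureCompletion S z).re := by
  rw [re_harmonicMeasureCompletion hS hz]
  refine circleAverage_nonneg_of_nonneg fun ζ hζ => ?_
  rw [abs_one] at hζ
  exact mul_nonneg (poissonKernel_nonneg hz hζ) (indicator_one_mem_Icc ζ).1

/-- The harmonic measure of `S` vanishes on the part of the circle outside `S`. -/
lemma tendsto_re_harmonicMeasureCompletion (hS : IsClosed S) {θ : ℝ} (hθ : circleMap 0 1 θ ∉ S) :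
    Tendsto (fun r : ℝ => (harmonicMeasureCompletion S (circleMap 0 r θ)).re) (𝓝[<] 1) (𝓝 0) := by
  obtain ⟨c, hc, hcS⟩ := Metric.isOpen_iff.1 hS.isOpen_compl _ hθ
  have hlim : Tendsto (fun r : ℝ => (1 - r ^ 2) / (c / 2) ^ 2) (𝓝[<] 1) (𝓝 0) := by
    have : Continuous fun r : ℝ => (1 - r ^ 2) / (c / 2) ^ 2 := by fun_prop
    simpa using (this.tendsto 1).mono_left nhdsWithin_le_nhds
  refine squeeze_zero' ?_ ?_ hlim
  · filter_upwards [Ioo_mem_nhdsLT (zero_lt_one (α := ℝ))] with r hr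
    exact re_harmonicMeasureCompletion_nonneg hS (circleMap_mem_ball hr.1.le hr.2 θ)
  · filter_upwards [Ioo_mem_nhdsLT (zero_lt_one (α := ℝ)),
      Ioo_mem_nhdsLT (show 1 - c / 2 < 1 by linarith)] with r hr hrc
    have hz := circleMap_mem_ball hr.1.le hr.2 θ
    rw [re_harmonicMeasureCompletion hS hz]
    refine circleAverage_mono_on_of_le_circle
      (circleIntegrable_poissonKernel_mul_indicator hS hz) fun ζ hζ => ?_
    rw [abs_one, mem_sphere, dist_zero_right] at hζ
    by_cases hζS : ζ ∈ S
    · have h1 : c ≤ ‖ζ - circleMap 0 1 θ‖ := by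
        by_contra h
        exact hcS (by rw [mem_ball, dist_eq_norm]; exact not_le.1 h) hζS
      have h2 : ‖circleMap 0 r θ - circleMap 0 1 θ‖ = 1 - r := by
        rw [circleMap_zero_eq_mul, show (r : ℂ) * circleMap 0 1 θ - circleMap 0 1 θ =
          ((r - 1 : ℝ) : ℂ) * circleMap 0 1 θ by push_cast; ring, norm_mul, Complex.norm_real,
          norm_circleMap_zero, abs_one, mul_one, norm_eq_abs, abs_of_neg (by linarith [hr.2])]
        ring
      have h3 := norm_sub_le_norm_sub_add_norm_sub ζ (circleMap 0 r θ) (circleMap 0 1 θ)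
      have h4 : c / 2 ≤ ‖ζ - circleMap 0 r θ‖ := by linarith [hrc.1]
      have h5 : r ^ 2 ≤ 1 := by nlinarith [hr.1, hr.2]
      simp only [hζS, indicator_of_mem, Pi.one_apply, mul_one, poissonKernel_def, sub_zero, hζ,
        norm_circleMap_zero, sq_abs, one_pow]
      have : 0 ≤ 1 - r ^ 2 := by linarith
      gcongr
    · simp only [hζS, not_false_eq_true, indicator_of_notMem, mul_zero]
      exact div_nonneg (by nlinarith [hr.1, hr.2]) (by positivity)

/-- The weighted estimate: smallness of the boundary function on the part of the circle in `S`
propagates to the circle of radius `r`, with an exponent given by the harmonic measure of `S`.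
It follows from Parseval's identity for the product of `∑ bₙ zⁿ` with the outer function of modulus
`T^{-1/2}` on `S` and `1` on the rest of the circle. -/
lemma tsum_sq_mul_pow_le {b : ℕ → ℂ} (hb : Summable fun n => ‖b n‖) (hS : IsClosed S) {r T : ℝ}
    (hr0 : 0 < r) (hr1 : r < 1) (hT0 : 0 < T) (hT1 : T ≤ 1) :
    ∑' n, ‖b n‖ ^ 2 * r ^ (2 * n) ≤
      T ^ ((1 - r) / (1 + r) * circleAverage (S.indicator 1) 0 1) *
        (1 / (2 * π) * (1 / T * (∫ θ in (0 : ℝ)..(2 * π),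
            S.indicator 1 (circleMap 0 1 θ) * ‖powerSum b (circleMap 0 1 θ)‖ ^ 2) +
          ∫ θ in (0 : ℝ)..(2 * π), ‖powerSum b (circleMap 0 1 θ)‖ ^ 2)) := by
  set G := powerSum b with hG
  set H := harmonicMeasureCompletion S with hH
  set κ := (1 - r) / (1 + r) * circleAverage (S.indicator (1 : ℂ → ℝ)) 0 1 with hκ
  set h : ℂ → ℂ := fun z => Complex.exp (-((Real.log T / 2 : ℝ) : ℂ) * H z) with hh
  have hHd : DifferentiableOn ℂ H (ball 0 1) := differentiableOn_harmonicMeasureCompletion hS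
  have hGd : DifferentiableOn ℂ G (ball 0 1) := differentiableOn_powerSum hb
  have hGc : ContinuousOn G (closedBall 0 1) := continuousOn_powerSum hb
  have hhn : ∀ z, ‖h z‖ ^ 2 = T ^ (-(H z).re) := by
    intro z
    rw [hh, Complex.norm_exp, ← Real.exp_nat_mul, Real.rpow_def_of_pos hT0]
    congr 1
    rw [← Complex.ofReal_neg, Complex.re_ofReal_mul]
    push_cast; ring
  have hFd : DifferentiableOn ℂ (fun z => G z * h z) (ball 0 1) :=
    hGd.mul ((hHd.const_mul _).cexp)
  have hFn : ∀ z, ‖G z * h z‖ ^ 2 = ‖G z‖ ^ 2 * T ^ (-(H z).re) := fun z => by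
    rw [norm_mul, mul_pow, hhn]
  -- continuity on the circles of radius less than one
  have hcontG : ∀ R ∈ Icc (0 : ℝ) 1, Continuous fun θ : ℝ => ‖G (circleMap 0 R θ)‖ ^ 2 := by
    intro R hR
    exact (hGc.comp_continuous (continuous_circleMap 0 R) fun θ => by
      simpa [abs_of_nonneg hR.1] using hR.2).norm.pow 2
  have hcontW : ∀ R ∈ Ioo (0 : ℝ) 1,
      Continuous fun θ : ℝ => T ^ (-(H (circleMap 0 R θ)).re) := by
    intro R hR
    have h1 : Continuous fun θ : ℝ => H (circleMap 0 R θ) :=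
      hHd.continuousOn.comp_continuous (continuous_circleMap 0 R)
        fun θ => circleMap_mem_ball hR.1.le hR.2 θ
    exact Continuous.rpow continuous_const (Complex.continuous_re.comp h1).neg
      fun θ => Or.inl hT0.ne'
  -- the lower bound on the circle of radius `r`
  have hlow : T ^ (-κ) * ∑' n, ‖b n‖ ^ 2 * r ^ (2 * n) ≤
      1 / (2 * π) * ∫ θ in (0 : ℝ)..(2 * π), ‖G (circleMap 0 r θ) * h (circleMap 0 r θ)‖ ^ 2 := by
    have hbr : Summable fun n => ‖b n * (r : ℂ) ^ n‖ :=
      Summable.of_nonneg_of_le (fun _ => norm_nonneg _)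
        (fun n => norm_mul_pow_le (by simpa [abs_of_pos hr0] using hr1.le)) hb
    rw [(hasSum_sq_mul_pow hr0.le hbr).tsum_eq, mul_left_comm, ← intervalIntegral.integral_const_mul]
    simp_rw [hFn]
    gcongr
    refine intervalIntegral.integral_mono_on (by positivity)
      (((hcontG r ⟨hr0.le, hr1.le⟩).const_mul _).intervalIntegrable _ _)
      (((hcontG r ⟨hr0.le, hr1.le⟩).mul (hcontW r ⟨hr0, hr1⟩)).intervalIntegrable _ _)
      fun θ _ => ?_
    rw [mul_comm]
    have h5 := le_re_harmonicMeasureCompletion hS (circleMap_mem_ball hr0.le hr1 θ)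
    rw [norm_circleMap_zero, abs_of_pos hr0] at h5
    exact mul_le_mul_of_nonneg_left
      (Real.rpow_le_rpow_of_exponent_ge hT0 hT1 (neg_le_neg h5)) (by positivity)
  set χ : ℝ → ℝ := fun θ => S.indicator 1 (circleMap 0 1 θ) with hχ
  have hχ01 : ∀ θ, χ θ = 0 ∨ χ θ = 1 := fun θ => by
    by_cases hθ : circleMap 0 1 θ ∈ S <;> simp [hχ, hθ]
  have hχi : IntervalIntegrable χ volume 0 (2 * π) := circleIntegrable_indicator_one hS
  have hχi' : IntervalIntegrable (fun θ => 1 - χ θ) volume 0 (2 * π) :=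
    intervalIntegrable_const.sub hχi
  have hWle : ∀ R ∈ Ioo (0 : ℝ) 1, ∀ θ, T ^ (-(H (circleMap 0 R θ)).re) ≤ 1 / T := by
    intro R hR θ
    rw [one_div, ← Real.rpow_neg_one]
    exact Real.rpow_le_rpow_of_exponent_ge hT0 hT1
      (neg_le_neg (re_harmonicMeasureCompletion_le_one hS (circleMap_mem_ball hR.1.le hR.2 θ)))
  set J : ℝ → ℝ → ℝ := fun R θ => χ θ * (1 / T * ‖G (circleMap 0 R θ)‖ ^ 2) +
    (1 - χ θ) * (‖G (circleMap 0 R θ)‖ ^ 2 * T ^ (-(H (circleMap 0 R θ)).re)) with hJ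
  have hJi : ∀ R ∈ Ioo (0 : ℝ) 1, IntervalIntegrable (J R) volume 0 (2 * π) := by
    intro R hR
    have h1 := hcontG R ⟨hR.1.le, hR.2.le⟩
    exact (hχi.mul_continuousOn (h1.const_mul (1 / T)).continuousOn).add
      (hχi'.mul_continuousOn (h1.mul (hcontW R hR)).continuousOn)
  -- means over circles increase with the radius
  have hmono : ∀ R ∈ Ioo r 1, T ^ (-κ) * ∑' n, ‖b n‖ ^ 2 * r ^ (2 * n) ≤
      1 / (2 * π) * ∫ θ in (0 : ℝ)..(2 * π), J R θ := by
    intro R hR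
    have hR0 : 0 < R := hr0.trans hR.1
    refine hlow.trans ?_
    refine (hasSum_le (fun n => ?_) (hasSum_sq_taylorCoeff hFd hr0.le hr1)
      (hasSum_sq_taylorCoeff hFd hR0.le hR.2)).trans ?_
    · have := hR.1.le
      gcongr
    simp_rw [hFn]
    gcongr
    refine intervalIntegral.integral_mono_on (by positivity)
      (((hcontG R ⟨hR0.le, hR.2.le⟩).mul (hcontW R ⟨hR0, hR.2⟩)).intervalIntegrable _ _)
      (hJi R ⟨hR0, hR.2⟩) fun θ _ => ?_
    rcases hχ01 θ with h1 | h1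
    · simp [hJ, h1]
    · simp only [hJ, h1, one_mul, sub_self, zero_mul, add_zero]
      rw [mul_comm]
      exact mul_le_mul_of_nonneg_right (hWle R ⟨hR0, hR.2⟩ θ) (by positivity)
  set B := ∑' n, ‖b n‖ with hB
  have hGB : ∀ R ∈ Ioo (0 : ℝ) 1, ∀ θ, ‖G (circleMap 0 R θ)‖ ^ 2 ≤ B ^ 2 := by
    intro R hR θ
    have : ‖G (circleMap 0 R θ)‖ ≤ B := tsum_of_norm_bounded hb.hasSum fun n =>
      norm_mul_pow_le (by simpa [abs_of_pos hR.1] using hR.2.le)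
    gcongr
  have hlim : Tendsto (fun R : ℝ => 1 / (2 * π) * ∫ θ in (0 : ℝ)..(2 * π), J R θ) (𝓝[<] 1)
      (𝓝 (1 / (2 * π) * ∫ θ in (0 : ℝ)..(2 * π), (χ θ * (1 / T * ‖G (circleMap 0 1 θ)‖ ^ 2) +
        (1 - χ θ) * ‖G (circleMap 0 1 θ)‖ ^ 2))) := by
    refine Tendsto.const_mul _ ?_
    refine intervalIntegral.tendsto_integral_filter_of_dominated_convergence
      (fun _ => 1 / T * B ^ 2) ?_ ?_ (by simp) (ae_of_all _ fun θ _ => ?_)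
    · filter_upwards [Ioo_mem_nhdsLT (zero_lt_one (α := ℝ))] with R hR
      exact (intervalIntegrable_iff.1 (hJi R hR)).aestronglyMeasurable
    · filter_upwards [Ioo_mem_nhdsLT (zero_lt_one (α := ℝ))] with R hR
      refine ae_of_all _ fun θ _ => ?_
      have h2 := hGB R hR θ
      have h3 := hWle R hR θ
      have h4 : 0 < T ^ (-(H (circleMap 0 R θ)).re) := Real.rpow_pos_of_pos hT0 _
      rcases hχ01 θ with h1 | h1
      · simp only [hJ, h1, zero_mul, sub_zero, one_mul, zero_add]
        rw [norm_of_nonneg (by positivity), mul_comm]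
        gcongr
      · simp only [hJ, h1, one_mul, sub_self, zero_mul, add_zero]
        rw [norm_of_nonneg (by positivity)]
        gcongr
    · have h2 : Tendsto (fun R : ℝ => ‖G (circleMap 0 R θ)‖ ^ 2) (𝓝[<] 1)
          (𝓝 (‖G (circleMap 0 1 θ)‖ ^ 2)) :=
        ((hGc _ (by simp)).tendsto.comp (tendsto_circleMap_radial θ)).norm.pow 2
      by_cases hθ : circleMap 0 1 θ ∈ S
      · have h1 : χ θ = 1 := by simp [hχ, hθ]
        simpa [hJ, h1] using h2.const_mul T⁻¹
      · have h1 : χ θ = 0 := by simp [hχ, hθ]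
        have h3 : Tendsto (fun R : ℝ => T ^ (-(H (circleMap 0 R θ)).re)) (𝓝[<] 1) (𝓝 1) := by
          have := (tendsto_re_harmonicMeasureCompletion hS hθ).neg
          rw [neg_zero] at this
          simpa [Function.comp_def] using
            (Real.continuousAt_const_rpow (b := 0) hT0.ne').tendsto.comp this
        simpa [hJ, h1] using h2.mul h3
  have hfin := ge_of_tendsto hlim (by
    filter_upwards [Ioo_mem_nhdsLT hr1] with R hR using hmono R hR)
  have hcont1 := hcontG 1 ⟨zero_le_one, le_rfl⟩
  have hi1 : IntervalIntegrable (fun θ => χ θ * ‖G (circleMap 0 1 θ)‖ ^ 2) volume 0 (2 * π) :=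
    hχi.mul_continuousOn hcont1.continuousOn
  have hle : ∫ θ in (0 : ℝ)..(2 * π), (χ θ * (1 / T * ‖G (circleMap 0 1 θ)‖ ^ 2) +
        (1 - χ θ) * ‖G (circleMap 0 1 θ)‖ ^ 2) ≤
      1 / T * (∫ θ in (0 : ℝ)..(2 * π), χ θ * ‖G (circleMap 0 1 θ)‖ ^ 2) +
        ∫ θ in (0 : ℝ)..(2 * π), ‖G (circleMap 0 1 θ)‖ ^ 2 := by
    rw [← intervalIntegral.integral_const_mul, ← intervalIntegral.integral_add
      (hi1.const_mul _) (hcont1.intervalIntegrable _ _)]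
    refine intervalIntegral.integral_mono_on (by positivity)
      ((hχi.mul_continuousOn (hcont1.const_mul (1 / T)).continuousOn).add
        (hχi'.mul_continuousOn hcont1.continuousOn))
      ((hi1.const_mul _).add (hcont1.intervalIntegrable _ _)) fun θ _ => ?_
    have : (1 - χ θ) * ‖G (circleMap 0 1 θ)‖ ^ 2 ≤ ‖G (circleMap 0 1 θ)‖ ^ 2 :=
      mul_le_of_le_one_left (by positivity) (by rcases hχ01 θ with h1 | h1 <;> simp [h1])
    linarith
  have hTκ : 0 < T ^ κ := Real.rpow_pos_of_pos hT0 _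
  calc ∑' n, ‖b n‖ ^ 2 * r ^ (2 * n)
      = T ^ κ * (T ^ (-κ) * ∑' n, ‖b n‖ ^ 2 * r ^ (2 * n)) := by
        rw [← mul_assoc, ← Real.rpow_add hT0, add_neg_cancel, Real.rpow_zero, one_mul]
    _ ≤ _ := mul_le_mul_of_nonneg_left
        (hfin.trans (mul_le_mul_of_nonneg_left hle (by positivity))) hTκ.le

end HarmonicMeasure

/-! ### The logarithmic estimate for sequences of coefficients -/

/-- The closed subarc of the unit circle with the angles in the closure of `arc a lam`. -/
def closedArc (a lam : ℝ) : Set ℂ := circleMap 0 1 '' Icc a (a + 2 * π * lam)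

lemma isClosed_closedArc (a lam : ℝ) : IsClosed (closedArc a lam) :=
  (isCompact_Icc.image (continuous_circleMap 0 1)).isClosed

lemma circleMap_mem_closedArc_iff {a lam θ : ℝ} (hlam : lam < 1)
    (hθ : θ ∈ Ioo a (a + 2 * π)) :
    circleMap 0 1 θ ∈ closedArc a lam ↔ θ ∈ Icc a (a + 2 * π * lam) := by
  refine ⟨?_, fun h => ⟨θ, h, rfl⟩⟩
  rintro ⟨s, hs, hsθ⟩
  have hs2 : s < a + 2 * π := by
    have := hs.2
    nlinarith [Real.pi_pos]
  set δ := (a + 2 * π - max s θ) / 2 with hδ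
  have hmax : max s θ < a + 2 * π := max_lt hs2 hθ.2
  have hδ0 : 0 < δ := by rw [hδ]; linarith
  have hinj := injOn_circleMap_of_abs_sub_le (a := a - δ) (b := a - δ + 2 * π) (c := 0)
    (one_ne_zero (α := ℝ)) (by
      rw [show a - δ - (a - δ + 2 * π) = -(2 * π) by ring, abs_neg, abs_of_pos two_pi_pos])
  rw [uIoc_of_le (by linarith [Real.pi_pos])] at hinj
  have h1 := le_max_left s θ
  have h2 := le_max_right s θ
  have : s = θ := hinj ⟨by linarith [hs.1], by linarith⟩ ⟨by linarith [hθ.1], by linarith⟩ hsθ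
  exact this ▸ hs

lemma integral_indicator_closedArc_mul {a lam : ℝ} (hlam1 : lam < 1)
    (v : ℂ → ℝ) :
    ∫ θ in (0 : ℝ)..(2 * π), (closedArc a lam).indicator 1 (circleMap 0 1 θ) *
      v (circleMap 0 1 θ) = ∫ θ in arc a lam, v (circleMap 0 1 θ) := by
  have hper : Function.Periodic (fun θ => (closedArc a lam).indicator 1 (circleMap 0 1 θ) *
      v (circleMap 0 1 θ)) (2 * π) := fun θ => by simp [periodic_circleMap 0 1 θ]
  have h1 := hper.intervalIntegral_add_eq 0 a
  rw [zero_add] at h1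
  have hsub : arc a lam ⊆ Ioc a (a + 2 * π) := fun θ hθ =>
    ⟨hθ.1, by have := hθ.2; nlinarith [Real.pi_pos]⟩
  rw [h1, intervalIntegral.integral_of_le (by linarith [Real.pi_pos])]
  have h2 : ∫ θ in Ioc a (a + 2 * π), (arc a lam).indicator (fun θ => v (circleMap 0 1 θ)) θ =
      ∫ θ in arc a lam, v (circleMap 0 1 θ) := by
    rw [setIntegral_indicator (show MeasurableSet (arc a lam) from measurableSet_Ioo),
      inter_eq_right.2 hsub]
  rw [← h2]
  refine setIntegral_congr_ae measurableSet_Ioc ?_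
  filter_upwards [compl_mem_ae_iff.2 (measure_singleton (a + 2 * π)),
    compl_mem_ae_iff.2 (measure_singleton (a + 2 * π * lam))] with θ hθ1 hθ2 hθ
  have hθ' : θ ∈ Ioo a (a + 2 * π) := ⟨hθ.1, lt_of_le_of_ne hθ.2 hθ1⟩
  have hiff := circleMap_mem_closedArc_iff (lam := lam) hlam1 hθ'
  by_cases h : θ ∈ arc a lam
  · rw [indicator_of_mem h, indicator_of_mem (hiff.2 ⟨h.1.le, h.2.le⟩)]
    simp
  · rw [indicator_of_notMem h, indicator_of_notMem, zero_mul]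
    intro h3
    have h4 := hiff.1 h3
    exact h ⟨hθ.1, lt_of_le_of_ne h4.2 hθ2⟩

lemma circleAverage_indicator_closedArc {a lam : ℝ} (hlam0 : 0 < lam) (hlam1 : lam < 1) :
    circleAverage ((closedArc a lam).indicator (1 : ℂ → ℝ)) 0 1 = lam := by
  have h := integral_indicator_closedArc_mul (a := a) hlam1 (fun _ => 1)
  simp only [mul_one] at h
  rw [circleAverage_def, h]
  simp only [arc, setIntegral_const, smul_eq_mul, mul_one, volume_real_Ioo_of_le
    (show a ≤ a + 2 * π * lam by nlinarith [Real.pi_pos, mul_pos Real.pi_pos hlam0])]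
  field_simp
  ring

lemma summable_norm_of_summable_sq {b : ℕ → ℂ}
    (hb : Summable fun n : ℕ => (n : ℝ) ^ 2 * ‖b n‖ ^ 2) :
    Summable fun n => ‖b n‖ := by
  refine (summable_nat_add_iff 1).1 ?_
  have h1 := (summable_nat_add_iff 1).2 (Real.summable_one_div_nat_pow.2 one_lt_two)
  have h2 := (summable_nat_add_iff 1).2 hb
  refine Summable.of_nonneg_of_le (fun n => norm_nonneg _) (fun n => ?_) (h1.add h2)
  have h3 : (0 : ℝ) < ((n + 1 : ℕ) : ℝ) := by positivity
  set x : ℝ := ((n + 1 : ℕ) : ℝ)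
  have h4 : ‖b (n + 1)‖ = 1 / x * (x * ‖b (n + 1)‖) := by field_simp
  have h5 : (1 / x) ^ 2 = 1 / x ^ 2 := by rw [div_pow, one_pow]
  rw [← h5, ← mul_pow]
  refine h4.trans_le ?_
  nlinarith [sq_nonneg (1 / x - x * ‖b (n + 1)‖), sq_nonneg (1 / x), sq_nonneg (x * ‖b (n + 1)‖)]

lemma exp_neg_two_mul_le_one_sub {s : ℝ} (h0 : 0 ≤ s) (h1 : s ≤ 1 / 2) :
    Real.exp (-(2 * s)) ≤ 1 - s := by
  have h2 := Real.add_one_le_exp (2 * s)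
  rw [Real.exp_neg]
  refine inv_le_of_inv_le₀ (by linarith) (le_trans ?_ h2)
  rw [inv_le_iff_one_le_mul₀ (by linarith)]
  nlinarith

/-- Low frequencies `n ≤ 1/s` are controlled on the circle of radius `1 - s`, high frequencies by
the smoothness. -/
lemma sq_le_low_add_high {s x : ℝ} (h0 : 0 < s) (h1 : s ≤ 1 / 2) (hx : 0 ≤ x) (n q : ℕ) :
    x ≤ Real.exp 4 * (x * (1 - s) ^ (2 * n)) + s ^ (2 * q) * ((n : ℝ) ^ (2 * q) * x) := by
  by_cases hn : 1 ≤ s * n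
  · have h2 : 1 ≤ s ^ (2 * q) * (n : ℝ) ^ (2 * q) := by
      rw [← mul_pow]; exact one_le_pow₀ hn
    have h3 : 0 ≤ Real.exp 4 * (x * (1 - s) ^ (2 * n)) := by
      have : 0 ≤ 1 - s := by linarith
      positivity
    nlinarith
  · have h2 : Real.exp (-4) ≤ (1 - s) ^ (2 * n) := by
      calc Real.exp (-4) ≤ Real.exp ((2 * n : ℕ) * (-(2 * s))) := by
            rw [Real.exp_le_exp]
            push_cast
            nlinarith [not_le.1 hn]
        _ = Real.exp (-(2 * s)) ^ (2 * n) := Real.exp_nat_mul _ _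
        _ ≤ _ := pow_le_pow_left₀ (Real.exp_pos _).le (exp_neg_two_mul_le_one_sub h0.le h1) _
    have h3 : 1 ≤ Real.exp 4 * (1 - s) ^ (2 * n) := by
      calc (1 : ℝ) = Real.exp 4 * Real.exp (-4) := by rw [← Real.exp_add]; simp
        _ ≤ _ := by gcongr
    have h4 : 0 ≤ s ^ (2 * q) * ((n : ℝ) ^ (2 * q) * x) := by positivity
    nlinarith

/-- The case of the theorem without derivatives, for a power series with coefficients `b` whose
derivatives of order `q` are controlled. The radius `1 - s` is chosen so that the weighted estimate
gains a fixed factor `e⁻⁵`, which absorbs the low frequencies into the left-hand side. -/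
lemma exists_tsum_sq_le (q : ℕ) (hq : 1 ≤ q) {A : ℝ} (hA : 0 ≤ A) :
    ∃ K : ℝ, 0 < K ∧ ∀ lam ∈ Ioo (0 : ℝ) 1, ∀ a : ℝ, ∀ b : ℕ → ℂ,
      (Summable fun n : ℕ => (n : ℝ) ^ (2 * q) * ‖b n‖ ^ 2) →
      ∑' n : ℕ, (n : ℝ) ^ (2 * q) * ‖b n‖ ^ 2 ≤ A → ∑' n, ‖b n‖ ^ 2 ≤ A →
      ∀ T ∈ Ioo (0 : ℝ) 1,
        ∫ θ in arc a lam, ‖powerSum b (circleMap 0 1 θ)‖ ^ 2 ≤ 2 * π * lam * T ^ 2 →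
        ∑' n, ‖b n‖ ^ 2 ≤ K / (lam * Real.log (1 / T)) ^ (2 * q) := by
  refine ⟨(2 * q).factorial + 2 * A * 20 ^ (2 * q), by positivity, ?_⟩
  intro lam hlam a b hsum hAq hA0 T hT hsmall
  set L := Real.log (1 / T) with hL
  have hTL : T = Real.exp (-L) := by
    rw [hL, one_div, Real.log_inv, neg_neg, Real.exp_log hT.1]
  have hL0 : 0 < L := Real.log_pos (by rw [one_div]; exact (one_lt_inv₀ hT.1).2 hT.2)
  set x := lam * L with hx
  have hx0 : 0 < x := mul_pos hlam.1 hL0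
  have hxL : x ≤ L := mul_le_of_le_one_left hL0.le hlam.2.le
  -- with `κ = λ (1 - r) / (1 + r) ≥ λ s / 2` this gives `T ^ κ ≤ exp (-5)`, which beats the
  -- factor `exp 4` of the low frequencies
  set s := 10 / x with hs
  have hs0 : 0 < s := by positivity
  have hb : Summable fun n => ‖b n‖ := by
    refine summable_norm_of_summable_sq (Summable.of_nonneg_of_le (fun n => by positivity)
      (fun n => ?_) hsum)
    refine mul_le_mul_of_nonneg_right ?_ (by positivity)
    rcases Nat.eq_zero_or_pos n with rfl | hn
    · simp
    · exact pow_le_pow_right₀ (by exact_mod_cast hn) (by omega)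
  have hb2 := hasSum_sq_of_summable_norm hb
  rcases le_or_gt s (1 / 2) with hs2 | hs2
  · have hr0 : 0 < 1 - s := by linarith
    have hr1 : 1 - s < 1 := by linarith
    have hW := tsum_sq_mul_pow_le hb (isClosed_closedArc a lam) hr0 hr1 hT.1 hT.2.le
    rw [circleAverage_indicator_closedArc hlam.1 hlam.2, integral_indicator_closedArc_mul
      hlam.2 (fun z => ‖powerSum b z‖ ^ 2)] at hW
    set M := ∑' n, ‖b n‖ ^ 2 with hM
    have hM0 : 0 ≤ M := tsum_nonneg fun n => by positivity
    have hin : 1 / (2 * π) * (1 / T * (∫ θ in arc a lam, ‖powerSum b (circleMap 0 1 θ)‖ ^ 2) +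
        ∫ θ in (0 : ℝ)..(2 * π), ‖powerSum b (circleMap 0 1 θ)‖ ^ 2) ≤ T + M := by
      rw [mul_add, ← hb2.tsum_eq]
      gcongr
      calc _ ≤ 1 / (2 * π) * (1 / T * (2 * π * lam * T ^ 2)) := by
            have := hT.1
            gcongr
        _ = lam * T := by
            have := hT.1.ne'
            field_simp
        _ ≤ T := mul_le_of_le_one_left hT.1.le hlam.2.le
    have hTκ : T ^ ((1 - (1 - s)) / (1 + (1 - s)) * lam) ≤ Real.exp (-5) := by
      rw [hTL, ← Real.exp_mul, Real.exp_le_exp]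
      have h1 : s / 2 ≤ (1 - (1 - s)) / (1 + (1 - s)) := by
        rw [sub_sub_cancel]
        gcongr
        linarith
      have h2 : s / 2 * lam * L = 5 := by
        rw [hs, hx]
        have := hlam.1.ne'
        field_simp
        norm_num
      have h3 : s / 2 * lam * L ≤ (1 - (1 - s)) / (1 + (1 - s)) * lam * L := by
        have := hlam.1.le
        gcongr
      linarith
    have hlow : ∑' n, ‖b n‖ ^ 2 * (1 - s) ^ (2 * n) ≤ Real.exp (-5) * (T + M) := by
      refine hW.trans (mul_le_mul hTκ hin ?_ (Real.exp_pos _).le)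
      have h1 : 0 ≤ ∫ θ in arc a lam, ‖powerSum b (circleMap 0 1 θ)‖ ^ 2 :=
        integral_nonneg fun θ => by positivity
      have h2 : 0 ≤ ∫ θ in (0 : ℝ)..(2 * π), ‖powerSum b (circleMap 0 1 θ)‖ ^ 2 :=
        intervalIntegral.integral_nonneg (by positivity) fun θ _ => by positivity
      have := hT.1
      positivity
    have hsumr : Summable fun n => ‖b n‖ ^ 2 * (1 - s) ^ (2 * n) :=
      Summable.of_nonneg_of_le (fun n => by positivity)
        (fun n => mul_le_of_le_one_right (by positivity) (pow_le_one₀ hr0.le hr1.le)) hb2.summable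
    have hMle : M ≤ Real.exp 4 * (Real.exp (-5) * (T + M)) + s ^ (2 * q) * A := by
      calc M ≤ ∑' n : ℕ, (Real.exp 4 * (‖b n‖ ^ 2 * (1 - s) ^ (2 * n)) +
            s ^ (2 * q) * ((n : ℝ) ^ (2 * q) * ‖b n‖ ^ 2)) :=
          hb2.summable.tsum_le_tsum (fun n => sq_le_low_add_high hs0 hs2 (by positivity) n q)
            ((hsumr.mul_left _).add (hsum.mul_left _))
        _ = Real.exp 4 * ∑' n, ‖b n‖ ^ 2 * (1 - s) ^ (2 * n) +
            s ^ (2 * q) * ∑' n : ℕ, (n : ℝ) ^ (2 * q) * ‖b n‖ ^ 2 := by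
          rw [(hsumr.mul_left _).tsum_add (hsum.mul_left _), tsum_mul_left, tsum_mul_left]
        _ ≤ _ := by gcongr
    have he : Real.exp 4 * Real.exp (-5) ≤ 1 / 2 := by
      rw [← Real.exp_add, show (4 : ℝ) + -5 = -1 by norm_num, Real.exp_neg, one_div]
      exact inv_anti₀ (by norm_num) (by linarith [Real.add_one_le_exp (1 : ℝ)])
    have hTM : 0 ≤ T + M := by linarith [hT.1]
    have h3 : Real.exp 4 * (Real.exp (-5) * (T + M)) ≤ 1 / 2 * (T + M) := by
      rw [← mul_assoc]
      exact mul_le_mul_of_nonneg_right he hTM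
    have h4 : M ≤ T + 2 * (s ^ (2 * q) * A) := by linarith
    have h5 : T ≤ (2 * q).factorial / x ^ (2 * q) := by
      rw [le_div_iff₀ (by positivity)]
      have h6 := Real.pow_div_factorial_le_exp (x := L) hL0.le (2 * q)
      rw [div_le_iff₀ (by positivity)] at h6
      calc T * x ^ (2 * q) ≤ T * (Real.exp L * (2 * q).factorial) := by
            have := hT.1.le
            gcongr
            exact (pow_le_pow_left₀ hx0.le hxL _).trans h6
        _ = (2 * q).factorial := by
            rw [hTL, ← mul_assoc, ← Real.exp_add]; simp
    have h7 : s ^ (2 * q) * A ≤ A * 20 ^ (2 * q) / x ^ (2 * q) := by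
      rw [hs, div_pow, div_mul_eq_mul_div, mul_comm]
      gcongr
      norm_num
    rw [add_div, show 2 * A * 20 ^ (2 * q) / x ^ (2 * q) = 2 * (A * 20 ^ (2 * q) / x ^ (2 * q)) by
      ring]
    linarith
  · -- for a large `s` the bound is trivial
    have hx20 : x ≤ 20 := by
      rw [hs, lt_div_iff₀ hx0] at hs2; linarith
    rw [le_div_iff₀ (by positivity)]
    calc (∑' n, ‖b n‖ ^ 2) * x ^ (2 * q) ≤ A * 20 ^ (2 * q) := by gcongr
      _ ≤ _ := by
        have : (0 : ℝ) ≤ (2 * q).factorial := by positivity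
        have : 0 ≤ A * 20 ^ (2 * q) := by positivity
        linarith

/-! ### Weak derivatives of the boundary function -/

lemma hasDerivAt_powerSum_circleMap {c : ℕ → ℂ} (hc : Summable fun n => ‖c n‖)
    (hc' : Summable fun n : ℕ => ‖(n : ℂ) * c n‖) (θ : ℝ) :
    HasDerivAt (fun θ : ℝ => powerSum c (circleMap 0 1 θ))
      (Complex.I * powerSum (fun n => n * c n) (circleMap 0 1 θ)) θ := by
  have h := hasDerivAt_tsum (𝕜 := ℝ) (g := fun n (t : ℝ) => c n * circleMap 0 1 t ^ n)
    (g' := fun n (t : ℝ) => Complex.I * (n * c n * circleMap 0 1 t ^ n)) (y₀ := θ) hc'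
    (fun n t => ?_) (fun n t => ?_) (hasSum_powerSum hc (by simp)).summable θ
  · rw [powerSum, ← tsum_mul_left]
    exact h
  · have h1 := ((hasDerivAt_circleMap 0 1 t).pow n).const_mul (c n)
    refine h1.congr_deriv ?_
    rcases n with _ | n
    · simp
    · rw [Nat.add_sub_cancel, pow_succ]
      ring
  · simp

lemma boundaryValue_eq_powerSum {f : ℂ → ℂ} (hf : DifferentiableOn ℂ f (ball 0 1))
    (ha : Summable fun n => ‖taylorCoeff f n‖) (θ : ℝ) :
    boundaryValue f θ = powerSum (taylorCoeff f) (circleMap 0 1 θ) := by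
  refine Tendsto.limUnder_eq ?_
  refine ((continuousOn_powerSum ha _ (by simp)).tendsto.comp
    (tendsto_circleMap_radial θ)).congr' ?_
  filter_upwards [Ioo_mem_nhdsLT (zero_lt_one (α := ℝ))] with R hR
  exact (hasSum_taylorCoeff hf (by simpa using circleMap_mem_ball hR.1.le hR.2 θ)).tsum_eq

lemma memLp_arc_of_continuous {u : ℝ → ℂ} (hu : Continuous u) (a lam : ℝ) :
    MemLp u 2 (volume.restrict (arc a lam)) := by
  obtain ⟨C, hC⟩ := (isCompact_Icc (a := a) (b := a + 2 * π * lam)).exists_bound_of_continuousOn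
    hu.continuousOn
  have : IsFiniteMeasure (volume.restrict (arc a lam)) := by
    unfold arc; infer_instance
  refine MemLp.of_bound hu.aestronglyMeasurable C ?_
  refine (ae_restrict_iff' measurableSet_Ioo).2 (ae_of_all _ fun θ hθ => hC θ ⟨hθ.1.le, hθ.2.le⟩)

lemma setIntegral_arc_smul_eq {φ : ℝ → ℝ} {a lam : ℝ} (hφ : tsupport φ ⊆ arc a lam)
    (w : ℝ → ℂ) : ∫ θ in arc a lam, φ θ • w θ = ∫ θ, φ θ • w θ := by
  refine setIntegral_eq_integral_of_forall_compl_eq_zero fun θ hθ => ?_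
  rw [image_eq_zero_of_notMem_tsupport fun h => hθ (hφ h), zero_smul]

lemma setIntegral_arc_deriv_smul {φ : ℝ → ℝ} {a lam : ℝ} (hφ : ContDiff ℝ ∞ φ)
    (hφc : HasCompactSupport φ) (hφs : tsupport φ ⊆ arc a lam) {w w' : ℝ → ℂ}
    (hw : ∀ θ, HasDerivAt w (w' θ) θ) (hw' : Continuous w') :
    ∫ θ in arc a lam, deriv φ θ • w θ = -∫ θ in arc a lam, φ θ • w' θ := by
  have hwc : Continuous w := continuous_iff_continuousAt.2 fun θ => (hw θ).continuousAt
  have hφ' : Continuous (deriv φ) := hφ.continuous_deriv (by simp)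
  rw [setIntegral_arc_smul_eq hφs, setIntegral_arc_smul_eq (tsupport_deriv_subset.trans hφs)]
  have h := integral_bilinear_hasDerivAt_right_eq_neg_left_of_integrable
    (L := ContinuousLinearMap.lsmul ℝ ℝ) (u := φ) (u' := deriv φ) (v := w) (v' := w')
    (fun x _ => (hφ.differentiable (by simp) x).hasDerivAt) (fun x _ => hw x)
    ((hφ.continuous.smul hw').integrable_of_hasCompactSupport hφc.smul_right)
    ((hφ'.smul hwc).integrable_of_hasCompactSupport hφc.deriv.smul_right)
    ((hφ.continuous.smul hwc).integrable_of_hasCompactSupport hφc.smul_right)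
  simp only [ContinuousLinearMap.lsmul_apply] at h
  rw [h, neg_neg]

/-- The weak derivative of order `j` of an absolutely convergent boundary series is obtained by
termwise differentiation, as long as the differentiated series converges absolutely. -/
lemma isWeakDeriv_powerSum {c : ℕ → ℂ} {j : ℕ}
    (hc : ∀ i ≤ j, Summable fun n : ℕ => ‖(n : ℂ) ^ i * c n‖) (a lam : ℝ) :
    IsWeakDeriv a lam j (fun θ => powerSum c (circleMap 0 1 θ))
      (fun θ => Complex.I ^ j * powerSum (fun n => (n : ℂ) ^ j * c n) (circleMap 0 1 θ)) := by
  have hcont : ∀ i ≤ j, Continuous fun θ : ℝ =>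
      Complex.I ^ i * powerSum (fun n => (n : ℂ) ^ i * c n) (circleMap 0 1 θ) := fun i hi =>
    continuous_const.mul (continuous_powerSum_circleMap (hc i hi))
  refine ⟨memLp_arc_of_continuous (by simpa using hcont 0 (Nat.zero_le _)) a lam,
    memLp_arc_of_continuous (hcont j le_rfl) a lam, ?_⟩
  clear hcont
  induction j with
  | zero => intro φ _ _ _; simp
  | succ j ih =>
    intro φ hφ hφc hφs
    rw [iteratedDeriv_succ', ih (fun i hi => hc i (hi.trans j.le_succ)) (deriv φ)
      (contDiff_infty_iff_deriv.1 hφ).2 hφc.deriv (tsupport_deriv_subset.trans hφs)]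
    have hs : ∀ n : ℕ, (n : ℂ) ^ (j + 1) * c n = n * ((n : ℂ) ^ j * c n) := fun n => by ring
    have hcs := hc (j + 1) le_rfl
    simp only [hs] at hcs
    have hcj := hc j j.le_succ
    have hder : ∀ θ : ℝ, HasDerivAt
        (fun θ => Complex.I ^ j * powerSum (fun n => (n : ℂ) ^ j * c n) (circleMap 0 1 θ))
        (Complex.I ^ (j + 1) * powerSum (fun n => (n : ℂ) ^ (j + 1) * c n) (circleMap 0 1 θ)) θ := by
      intro θ
      simp only [hs]
      rw [pow_succ, mul_assoc]
      exact (hasDerivAt_powerSum_circleMap hcj hcs θ).const_mul _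
    rw [setIntegral_arc_deriv_smul hφ hφc hφs hder
      (continuous_const.mul (continuous_powerSum_circleMap (hc (j + 1) le_rfl)))]
    ring

lemma IsWeakDeriv.ae_eq {a lam : ℝ} {j : ℕ} {u g₁ g₂ : ℝ → ℂ} (h₁ : IsWeakDeriv a lam j u g₁)
    (h₂ : IsWeakDeriv a lam j u g₂) : g₁ =ᵐ[volume.restrict (arc a lam)] g₂ := by
  have hfin : IsFiniteMeasure (volume.restrict (arc a lam)) := by
    unfold arc; infer_instance
  have hi₁ : IntegrableOn g₁ (arc a lam) := h₁.2.1.integrable (by norm_num)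
  have hi₂ : IntegrableOn g₂ (arc a lam) := h₂.2.1.integrable (by norm_num)
  have hz := IsOpen.ae_eq_zero_of_integral_contDiff_smul_eq_zero (μ := volume)
    (f := fun θ => g₁ θ - g₂ θ) (show IsOpen (arc a lam) from isOpen_Ioo)
    (hi₁.sub hi₂).locallyIntegrableOn (fun φ hφ hφc hφs => ?_)
  · refine (ae_restrict_iff' measurableSet_Ioo).2 ?_
    filter_upwards [hz] with θ hθ hθa using sub_eq_zero.1 (hθ hθa)
  · have h3 := (h₁.2.2 φ hφ hφc hφs).symm.trans (h₂.2.2 φ hφ hφc hφs)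
    have h4 := mul_left_cancel₀ (pow_ne_zero j (neg_ne_zero.2 (one_ne_zero (α := ℂ)))) h3
    obtain ⟨C, hC⟩ := hφ.continuous.bounded_above_of_compact_support hφc
    have hint : ∀ {g : ℝ → ℂ}, IntegrableOn g (arc a lam) →
        Integrable (fun θ => φ θ • g θ) (volume.restrict (arc a lam)) := fun hg =>
      Integrable.bdd_smul hg C hφ.continuous.aestronglyMeasurable (ae_of_all _ hC)
    rw [← setIntegral_arc_smul_eq hφs]
    simp only [smul_sub]
    rw [integral_sub (hint hi₁) (hint hi₂), h4, sub_self]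

lemma IsWeakDeriv.weakDeriv_ae_eq {a lam : ℝ} {j : ℕ} {u g : ℝ → ℂ} (h : IsWeakDeriv a lam j u g) :
    weakDeriv a lam j u =ᵐ[volume.restrict (arc a lam)] g := by
  have hex : ∃ g, IsWeakDeriv a lam j u g := ⟨g, h⟩
  rw [weakDeriv, dif_pos hex]
  exact hex.choose_spec.ae_eq h

lemma integral_arc_eq_arcNorm_sq {a lam : ℝ} (hlam : 0 < lam) (u : ℝ → ℂ) :
    ∫ θ in arc a lam, ‖u θ‖ ^ 2 = 2 * π * lam * arcNorm a lam u ^ 2 := by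
  have h : 0 ≤ ∫ θ in arc a lam, ‖u θ‖ ^ 2 := integral_nonneg fun θ => by positivity
  rw [arcNorm, Real.sq_sqrt (by positivity)]
  field_simp

lemma arcNorm_weakDeriv_le {a lam : ℝ} {m j : ℕ} (hj : j ≤ m) (f : ℂ → ℂ) :
    arcNorm a lam (weakDeriv a lam j (boundaryValue f)) ≤ arcSobolevNorm a lam m f := by
  refine Real.le_sqrt_of_sq_le ?_
  exact Finset.single_le_sum (f := fun i =>
    arcNorm a lam (weakDeriv a lam i (boundaryValue f)) ^ 2) (fun i _ => sq_nonneg _)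
    (Finset.mem_range.2 (by omega))

/-! ### Hardy–Sobolev norms in terms of Taylor coefficients -/

lemma taylorCoeff_iteratedDeriv (f : ℂ → ℂ) (j n : ℕ) :
    taylorCoeff (iteratedDeriv j f) n = ((n + j).descFactorial j : ℂ) * taylorCoeff f (n + j) := by
  have h1 : iteratedDeriv n (iteratedDeriv j f) = iteratedDeriv (n + j) f := by
    simp only [iteratedDeriv_eq_iterate, Function.iterate_add_apply]
  have h2 : (n.factorial : ℂ) * (n + j).descFactorial j = (n + j).factorial := by
    have := Nat.factorial_mul_descFactorial (n := n + j) (k := j) (by omega)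
    rw [Nat.add_sub_cancel] at this
    exact_mod_cast this
  have h3 : (n.factorial : ℂ) ≠ 0 := by exact_mod_cast n.factorial_ne_zero
  have h4 : ((n + j).factorial : ℂ) ≠ 0 := by exact_mod_cast (n + j).factorial_ne_zero
  rw [taylorCoeff, taylorCoeff, h1, ← h2]
  rw [← h2] at h4
  have h5 := right_ne_zero_of_mul h4
  field_simp

lemma hasSum_descFactorial_sq {f : ℂ → ℂ} {j : ℕ} (hf : MemHardy (iteratedDeriv j f)) :
    HasSum (fun n : ℕ => (n.descFactorial j : ℝ) ^ 2 * ‖taylorCoeff f n‖ ^ 2)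
      (hardyNorm (iteratedDeriv j f) ^ 2) := by
  have h := hf.hasSum_sq
  have h0 : ∑ n ∈ Finset.range j, (n.descFactorial j : ℝ) ^ 2 * ‖taylorCoeff f n‖ ^ 2 = 0 := by
    refine Finset.sum_eq_zero fun n hn => ?_
    rw [Nat.descFactorial_of_lt (Finset.mem_range.1 hn)]
    simp
  rw [← hasSum_nat_add_iff' j, h0, sub_zero]
  refine h.congr_fun fun n => ?_
  rw [taylorCoeff_iteratedDeriv, norm_mul, mul_pow, Complex.norm_natCast]

lemma pow_le_pow_mul_descFactorial_add_one {k : ℕ} (hk : 1 ≤ k) (n : ℕ) :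
    n ^ k ≤ k ^ k * (n.descFactorial k + 1) := by
  rcases lt_or_ge n k with h | h
  · calc n ^ k ≤ k ^ k := Nat.pow_le_pow_left h.le k
      _ ≤ _ := Nat.le_mul_of_pos_right _ (Nat.succ_pos _)
  · obtain ⟨p, rfl⟩ := Nat.exists_eq_add_of_le h
    have h1 := Nat.pow_sub_le_descFactorial (k + p) k
    rw [show k + p + 1 - k = p + 1 by omega] at h1
    calc (k + p) ^ k ≤ (k * (p + 1)) ^ k := Nat.pow_le_pow_left (by nlinarith) k
      _ = k ^ k * (p + 1) ^ k := mul_pow _ _ _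
      _ ≤ _ := Nat.mul_le_mul_left _ (h1.trans (Nat.le_succ _))

lemma hardyNorm_sq_le_one {k j : ℕ} {f : ℂ → ℂ} (hf : f ∈ unitBall k) (hj : j ≤ k) :
    hardyNorm (iteratedDeriv j f) ^ 2 ≤ 1 := by
  have h1 : ∑ i ∈ Finset.range (k + 1), hardyNorm (iteratedDeriv i f) ^ 2 ≤ 1 := by
    have := hf.2
    rwa [hardySobolevNorm, Real.sqrt_le_left zero_le_one, one_pow] at this
  exact (Finset.single_le_sum (f := fun i => hardyNorm (iteratedDeriv i f) ^ 2)
    (fun i _ => sq_nonneg _) (Finset.mem_range.2 (by omega))).trans h1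

/-- On the unit ball of `H^{k,2}` the power weights `n^{2i}`, `i ≤ k`, are controlled. -/
lemma summable_and_tsum_pow_mul_sq_le {k i : ℕ} (hk : 1 ≤ k) (hi : i ≤ k) {f : ℂ → ℂ}
    (hf : f ∈ unitBall k) :
    (Summable fun n : ℕ => (n : ℝ) ^ (2 * i) * ‖taylorCoeff f n‖ ^ 2) ∧
      ∑' n : ℕ, (n : ℝ) ^ (2 * i) * ‖taylorCoeff f n‖ ^ 2 ≤ 4 * (k : ℝ) ^ (2 * k) + 1 := by
  have hsk := hasSum_descFactorial_sq (hf.1 k le_rfl)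
  have hs0 := hasSum_descFactorial_sq (hf.1 0 (Nat.zero_le _))
  simp only [Nat.descFactorial_zero, Nat.cast_one, one_pow, one_mul] at hs0
  have hdom := ((hsk.add hs0).mul_left (2 * (k : ℝ) ^ (2 * k))).add hs0
  have hle : ∀ n : ℕ, (n : ℝ) ^ (2 * i) * ‖taylorCoeff f n‖ ^ 2 ≤
      2 * (k : ℝ) ^ (2 * k) * ((n.descFactorial k : ℝ) ^ 2 * ‖taylorCoeff f n‖ ^ 2 +
        ‖taylorCoeff f n‖ ^ 2) + ‖taylorCoeff f n‖ ^ 2 := by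
    intro n
    have h1 : (n : ℝ) ^ k ≤ (k : ℝ) ^ k * (n.descFactorial k + 1) := by
      exact_mod_cast pow_le_pow_mul_descFactorial_add_one hk n
    have h2 : (n : ℝ) ^ (2 * k) ≤ 2 * (k : ℝ) ^ (2 * k) * ((n.descFactorial k : ℝ) ^ 2 + 1) := by
      rw [mul_comm 2 k, pow_mul, pow_mul]
      calc ((n : ℝ) ^ k) ^ 2 ≤ ((k : ℝ) ^ k * (n.descFactorial k + 1)) ^ 2 := by gcongr
        _ = ((k : ℝ) ^ k) ^ 2 * ((n.descFactorial k : ℝ) + 1) ^ 2 := mul_pow _ _ _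
        _ ≤ ((k : ℝ) ^ k) ^ 2 * (2 * ((n.descFactorial k : ℝ) ^ 2 + 1)) := by
          gcongr
          nlinarith [sq_nonneg ((n.descFactorial k : ℝ) - 1)]
        _ = _ := by ring
    have h3 : (n : ℝ) ^ (2 * i) ≤ (n : ℝ) ^ (2 * k) + 1 := by
      rcases Nat.eq_zero_or_pos n with rfl | hn
      · have : ((0 : ℕ) : ℝ) ^ (2 * i) ≤ 1 := pow_le_one₀ (by simp) (by simp)
        have : (0 : ℝ) ≤ ((0 : ℕ) : ℝ) ^ (2 * k) := by positivity
        linarith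
      · have : (n : ℝ) ^ (2 * i) ≤ (n : ℝ) ^ (2 * k) :=
          pow_le_pow_right₀ (by exact_mod_cast hn) (by omega)
        linarith
    calc _ ≤ (2 * (k : ℝ) ^ (2 * k) * ((n.descFactorial k : ℝ) ^ 2 + 1) + 1) *
          ‖taylorCoeff f n‖ ^ 2 := by gcongr; linarith
      _ = _ := by ring
  have hs : Summable fun n : ℕ => (n : ℝ) ^ (2 * i) * ‖taylorCoeff f n‖ ^ 2 :=
    Summable.of_nonneg_of_le (fun n => by positivity) hle hdom.summable
  refine ⟨hs, (hasSum_le hle hs.hasSum hdom).trans ?_⟩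
  have h1 := hardyNorm_sq_le_one hf le_rfl
  have h0 := hardyNorm_sq_le_one hf (Nat.zero_le k)
  have : (0 : ℝ) ≤ 2 * (k : ℝ) ^ (2 * k) := by positivity
  nlinarith

lemma hardyNorm_iteratedDeriv_sq_le {j : ℕ} {f : ℂ → ℂ} (hf : MemHardy (iteratedDeriv j f))
    (hs : Summable fun n : ℕ => ‖(n : ℂ) ^ j * taylorCoeff f n‖ ^ 2) :
    hardyNorm (iteratedDeriv j f) ^ 2 ≤ ∑' n : ℕ, ‖(n : ℂ) ^ j * taylorCoeff f n‖ ^ 2 := by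
  refine hasSum_le (fun n => ?_) (hasSum_descFactorial_sq hf) hs.hasSum
  rw [norm_mul, mul_pow, norm_pow, Complex.norm_natCast]
  gcongr
  exact_mod_cast Nat.descFactorial_le_pow n j

/-- The estimate of the theorem with an arbitrary upper bound `T < 1` of the norm on the arc, which
covers the case of vanishing data. -/
lemma exists_hardySobolevNorm_le (k m : ℕ) (hmk : m < k) :
    ∃ α : ℝ, 0 < α ∧ ∀ lam ∈ Ioo (0 : ℝ) 1, ∀ a : ℝ, ∀ f ∈ unitBall k, ∀ T ∈ Ioo (0 : ℝ) 1,
      arcSobolevNorm a lam m f ≤ T →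
        hardySobolevNorm m f ≤ α / (lam * Real.log (1 / T)) ^ (k - m) := by
  have hk : 1 ≤ k := by omega
  set q := k - m with hq
  obtain ⟨K, hK, hmain⟩ := exists_tsum_sq_le q (by omega)
    (A := 4 * (k : ℝ) ^ (2 * k) + 1) (by positivity)
  refine ⟨√((m + 1) * K), by positivity, fun lam hlam a f hf T hT hsmall => ?_⟩
  set x := lam * Real.log (1 / T) with hx
  have hx0 : 0 < x := mul_pos hlam.1
    (Real.log_pos (by rw [one_div]; exact (one_lt_inv₀ hT.1).2 hT.2))
  set c := taylorCoeff f with hc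
  have hweight : ∀ i j n : ℕ, (n : ℝ) ^ (2 * i) * ‖(n : ℂ) ^ j * c n‖ ^ 2 =
      (n : ℝ) ^ (2 * (i + j)) * ‖c n‖ ^ 2 := fun i j n => by
    rw [norm_mul, norm_pow, Complex.norm_natCast]; ring
  have hcoef : ∀ i j : ℕ, i + j ≤ k →
      (Summable fun n : ℕ => (n : ℝ) ^ (2 * i) * ‖(n : ℂ) ^ j * c n‖ ^ 2) ∧
      ∑' n : ℕ, (n : ℝ) ^ (2 * i) * ‖(n : ℂ) ^ j * c n‖ ^ 2 ≤ 4 * (k : ℝ) ^ (2 * k) + 1 := by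
    intro i j hij
    simp only [hweight]
    exact summable_and_tsum_pow_mul_sq_le hk hij hf
  have habs : ∀ i ≤ m, Summable fun n : ℕ => ‖(n : ℂ) ^ i * c n‖ := fun i hi =>
    summable_norm_of_summable_sq (by simpa using (hcoef 1 i (by omega)).1)
  have hf0 : DifferentiableOn ℂ f (ball 0 1) := by simpa using (hf.1 0 (Nat.zero_le _)).1
  have hbv : boundaryValue f = fun θ => powerSum c (circleMap 0 1 θ) :=
    funext fun θ => boundaryValue_eq_powerSum hf0 (by simpa using habs 0 (Nat.zero_le _)) θ
  have hj : ∀ j ∈ Finset.range (m + 1),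
      hardyNorm (iteratedDeriv j f) ^ 2 ≤ K / x ^ (2 * q) := by
    intro j hjm
    rw [Finset.mem_range] at hjm
    have hs0 := hcoef 0 j (by omega)
    simp only [mul_zero, pow_zero, one_mul] at hs0
    refine (hardyNorm_iteratedDeriv_sq_le (hf.1 j (by omega)) hs0.1).trans ?_
    have hsq := hcoef q j (by omega)
    refine hmain lam hlam a _ hsq.1 hsq.2 hs0.2 T hT ?_
    have hwd := (isWeakDeriv_powerSum (c := c) (j := j) (fun i hi => habs i (by omega))
      a lam).weakDeriv_ae_eq
    rw [← hbv] at hwd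
    have h1 : ∫ θ in arc a lam, ‖powerSum (fun n => (n : ℂ) ^ j * c n) (circleMap 0 1 θ)‖ ^ 2 =
        ∫ θ in arc a lam, ‖weakDeriv a lam j (boundaryValue f) θ‖ ^ 2 := by
      refine integral_congr_ae ?_
      filter_upwards [hwd] with θ hθ
      rw [hθ, norm_mul, norm_pow, Complex.norm_I, one_pow, one_mul]
    rw [h1, integral_arc_eq_arcNorm_sq hlam.1]
    have h2 := (arcNorm_weakDeriv_le (a := a) (lam := lam) (j := j) (m := m) (by omega) f).trans
      hsmall
    have h3 : 0 ≤ arcNorm a lam (weakDeriv a lam j (boundaryValue f)) := Real.sqrt_nonneg _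
    have := hlam.1
    gcongr
  rw [hardySobolevNorm, Real.sqrt_le_left (by positivity), div_pow, Real.sq_sqrt (by positivity),
    ← pow_mul, mul_comm q 2]
  refine (Finset.sum_le_card_nsmul _ _ _ hj).trans_eq ?_
  rw [Finset.card_range, nsmul_eq_mul]
  push_cast; ring

end HardySobolev

end

theorem mainTheorem3 (k m : ℕ) (hmk : m < k) :
    ∃ α β : ℝ, 0 < α ∧ 0 < β ∧
      ∀ lam ∈ Set.Ioo (0 : ℝ) 1, ∀ a : ℝ, ∀ f ∈ HardySobolev.unitBall k,
        HardySobolev.arcSobolevNorm a lam m f ≤ β →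
          HardySobolev.hardySobolevNorm m f ≤
            α / (lam * Real.log (1 / HardySobolev.arcSobolevNorm a lam m f)) ^ (k - m) := by
  obtain ⟨α, hα, h⟩ := HardySobolev.exists_hardySobolevNorm_le k m hmk
  refine ⟨α, 1 / 2, hα, by norm_num, fun lam hlam a f hf hβ => ?_⟩
  have h0 : 0 ≤ HardySobolev.arcSobolevNorm a lam m f := Real.sqrt_nonneg _
  rcases h0.lt_or_eq with hpos | hzero
  · exact h lam hlam a f hf _ ⟨hpos, by linarith⟩ le_rfl
  · have hq : k - m ≠ 0 := by omega
    -- the right-hand side is `0` by `log (1 / 0) = 0` and division by zero; let the bound `T` of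
    -- the data tend to `0`
    rw [← hzero, div_zero, Real.log_zero, mul_zero, zero_pow hq, div_zero]
    have hlim : Tendsto (fun t : ℝ => α / (lam * t) ^ (k - m)) atTop (𝓝 0) :=
      Tendsto.div_atTop tendsto_const_nhds
        ((tendsto_pow_atTop hq).comp (tendsto_id.const_mul_atTop hlam.1))
    refine ge_of_tendsto hlim ?_
    filter_upwards [eventually_gt_atTop 0] with t ht
    have h1 := h lam hlam a f hf (Real.exp (-t))
      ⟨Real.exp_pos _, Real.exp_lt_one_iff.2 (by linarith)⟩ (hzero ▸ (Real.exp_pos _).le)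
    rwa [one_div, ← Real.exp_neg, neg_neg, Real.log_exp] at h1
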